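/- Let $\mathsf M$ be a symmetric monoidal category, with monoidal product written as juxtaposition, unit $I$ and symmetry $c$, in which equalizers exist and are preserved by taking the monoidal product with any object. The composite of $g:A\to B$ and $f:B\to C$ is written $f.g$ and identity morphisms are written $1$. For bimonoids in $\mathsf M$ write $m,u,\delta,\varepsilon$ for the multiplication, unit, comultiplication and counit. A bimonoid $B$ is a Hopf monoid if it has an antipode, i.e. a morphism $z:B\to B$ with $m.z1.\delta=u.\varepsilon=m.1z.\delta$; it is cocommutative if $c.\delta=\delta$. A split epimorphism of bimonoids consists of bimonoid morphisms $s:A\to B$ and $i:B\to A$ with $s.i=1$; a morphism $(A,B,s,i)\to(A',B',s',i')$ is a pair of bimonoid morphisms $b:B\to B'$, $a:A\to A'$ with $s'.a=b.s$ and $i'.b=a.i$. For such a split epimorphism let $j:A\square_B I\to A$ be the equalizer of $1s.\delta$ and $1u:A\to AB$, and let $q:=m.ji:(A\square_B I)B\to A$. Let $\mathsf{S}$ be the category of the split epimorphisms of bimonoids for which $c.s1.\delta=1s.\delta$ holds (with $\delta$ the comultiplication of $A$) and $q$ is invertible. An action consists of bimonoids $B$ and $Y$ and a left $B$-action $l:BY\to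 Y$ making $Y$ both a left $B$-module monoid and a left $B$-module comonoid (that is, the multiplication, the unit, the comultiplication and the counit of $Y$ are morphisms of left $B$-modules); a morphism $(B,Y,l)\to(B',Y',l')$ is a pair of bimonoid morphisms $b:B\to B'$, $y:Y\to Y'$ with $l'.by=y.l$. Let $\mathsf D$ be the category of those actions for which $B$ is cocommutative. For an action put $x:=l1.1c.\delta1:BY\to YB$. There is an equivalence $\mathsf S\simeq\mathsf D$. It sends a split epimorphism $(A,B,s,i)$ to $B$ and $Y=A\square_B I$ (with the bimonoid structure for which $j$ is a bimonoid morphism), with the action for which $q.x=m.ij$; its inverse sends $(B,Y,l)$ to $Y B$ with morphisms $u1:B\to YB$ and $\varepsilon 1:YB\to B$, where $YB$ has the multiplication $mm.1x1$, the unit $uu$ and the tensor product comonoid structure. Both descriptions are up to isomorphisms natural in the object. Moreover: (1) If a split epimorphism of bimonoids satisfies $c.s1.\delta=1s.\delta$ and $B$ is a Hopf monoid with antipode $z$, then $q$ is invertible and $q^{-1}$ is the morphism $A\to(A\square_B I)B$ satisfying $$j1.q^{-1}=m1.1i1.1z1.1\delta.1s.\delta .$$ The above equivalence restricts to an equivalence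 between - the full subcategory $\mathsf S_1$ of $\mathsf S$ of the split epimorphisms of bimonoids such that $c.s1.\delta=1s.\delta$ and $B$ is a Hopf monoid; - the full subcategory $\mathsf D_1$ of $\mathsf D$ of the actions for which $B$ is a cocommutative Hopf monoid (and $Y$ is any bimonoid). (2) The equivalence of part (1) restricts to an equivalence between - the full subcategory of $\mathsf S_1$ of the split epimorphisms for which both $A$ and $B$ are cocommutative Hopf monoids; - the full subcategory of $\mathsf D_1$ of the actions for which both $B$ and $Y$ are cocommutative Hopf monoids. -/

import Mathlib

open CategoryTheory MonoidalCategory Limits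
open scoped MonObj ComonObj

universe v u

noncomputable section

namespace BimonSplit

variable {M : Type u} [Category.{v} M] [MonoidalCategory M] [SymmetricCategory M]

/-- `z` is an antipode of the bimonoid `B`. -/
structure IsAntipode (B : M) [BimonObj B] (z : B ⟶ B) : Prop where
  left : Δ[B] ≫ z ▷ B ≫ μ[B] = ε[B] ≫ η[B]
  right : Δ[B] ≫ B ◁ z ≫ μ[B] = ε[B] ≫ η[B]

/-- The bimonoid `B` is a Hopf monoid: it has an antipode (which is then unique). -/
def IsHopf (B : M) [BimonObj B] : Prop := ∃ z : B ⟶ B, IsAntipode B z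

instance isBimonHom_id (A : M) [BimonObj A] : IsBimonHom (𝟙 A) where

instance isBimonHom_comp {A B C : M} [BimonObj A] [BimonObj B] [BimonObj C]
    (f : A ⟶ B) (g : B ⟶ C) [IsBimonHom f] [IsBimonHom g] : IsBimonHom (f ≫ g) where

variable (M) in
/-- Split epimorphisms of bimonoids in `M`: bimonoid morphisms `s : A ⟶ B` with a chosen section
`i : B ⟶ A` which is a bimonoid morphism as well. -/
structure SplitEpiBimon where
  A : M
  B : M
  [bimonA : BimonObj A]
  [bimonB : BimonObj B]
  i : B ⟶ A
  s : A ⟶ B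
  [bimon_i : IsBimonHom i]
  [bimon_s : IsBimonHom s]
  i_s : i ≫ s = 𝟙 B

namespace SplitEpiBimon

attribute [instance] bimonA bimonB bimon_i bimon_s

/-- Morphisms are pairs of bimonoid morphisms compatible with the epimorphisms and their
sections. -/
@[ext]
structure Hom (X X' : SplitEpiBimon M) where
  b : X.B ⟶ X'.B
  a : X.A ⟶ X'.A
  [bimon_b : IsBimonHom b]
  [bimon_a : IsBimonHom a]
  comm_s : a ≫ X'.s = X.s ≫ b
  comm_i : b ≫ X'.i = X.i ≫ a

attribute [instance] Hom.bimon_b Hom.bimon_a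

instance : Category (SplitEpiBimon M) where
  Hom := Hom
  id X :=
    { b := 𝟙 X.B
      a := 𝟙 X.A
      comm_s := by simp
      comm_i := by simp }
  comp {X Y Z} f g :=
    { b := f.b ≫ g.b
      a := f.a ≫ g.a
      comm_s := by rw [Category.assoc, g.comm_s, ← Category.assoc, f.comm_s, Category.assoc]
      comm_i := by rw [Category.assoc, g.comm_i, ← Category.assoc, f.comm_i, Category.assoc] }
  id_comp f := Hom.ext (Category.id_comp f.b) (Category.id_comp f.a)
  comp_id f := Hom.ext (Category.comp_id f.b) (Category.comp_id f.a)
  assoc f g h := Hom.ext (Category.assoc f.b g.b h.b) (Category.assoc f.a g.a h.a)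

/-- The condition `c.s1.δ = 1s.δ` on the comultiplication of `A`
(compositions written from right to left in this formula). -/
def CocommAlong (X : SplitEpiBimon M) : Prop :=
  Δ[X.A] ≫ X.s ▷ X.A ≫ (β_ X.B X.A).hom = Δ[X.A] ≫ X.A ◁ X.s

section Cotensor

variable [HasEqualizers M]

/-- The cotensor product `A □_B I` of `s : A ⟶ B` and the unit `I ⟶ B`: the equalizer of
`1s.δ` and `1u` from `A` to `A ⊗ B` (`A ⊗ I` is identified with `A`). -/
def cotensor (X : SplitEpiBimon M) : M :=
  equalizer (Δ[X.A] ≫ X.A ◁ X.s) ((ρ_ X.A).inv ≫ X.A ◁ η[X.B])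

/-- The equalizer inclusion `A □_B I ⟶ A`. -/
def j (X : SplitEpiBimon M) : X.cotensor ⟶ X.A :=
  equalizer.ι (Δ[X.A] ≫ X.A ◁ X.s) ((ρ_ X.A).inv ≫ X.A ◁ η[X.B])

/-- The morphism `q = m.ji` from `(A □_B I) ⊗ B` to `A`. -/
def q (X : SplitEpiBimon M) : X.cotensor ⊗ X.B ⟶ X.A :=
  (X.j ⊗ₘ X.i) ≫ μ[X.A]

variable (M) in
/-- Split epimorphisms of bimonoids with `c.s1.δ = 1s.δ` for which `q` is invertible. -/
def isRegular : ObjectProperty (SplitEpiBimon M) :=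
  fun X => X.CocommAlong ∧ IsIso X.q

end Cotensor

variable (M) in
/-- Split epimorphisms of bimonoids with `c.s1.δ = 1s.δ` whose codomain is a Hopf monoid. -/
def hopfCodomain : ObjectProperty (SplitEpiBimon M) :=
  fun X => X.CocommAlong ∧ IsHopf X.B

variable (M) in
/-- Split epimorphisms of cocommutative Hopf monoids. -/
def cocommHopf : ObjectProperty (SplitEpiBimon M) :=
  fun X => (IsCommComonObj X.A ∧ IsHopf X.A) ∧ (IsCommComonObj X.B ∧ IsHopf X.B)

end SplitEpiBimon

/-- The diagonal action of a bimonoid `B` on `V ⊗ W` induced by actions on `V` and `W`. -/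
def diagAct {B V W : M} [BimonObj B] (l : B ⊗ V ⟶ V) (l' : B ⊗ W ⟶ W) :
    B ⊗ (V ⊗ W) ⟶ V ⊗ W :=
  Δ[B] ▷ (V ⊗ W) ≫ tensorμ B B V W ≫ (l ⊗ₘ l')

/-- The trivial action of a bimonoid `B` on the monoidal unit, through the counit. -/
def trivAct (B : M) [BimonObj B] : B ⊗ 𝟙_ M ⟶ 𝟙_ M :=
  ε[B] ▷ 𝟙_ M ≫ (λ_ (𝟙_ M)).hom

variable (M) in
/-- Bimonoids `B` and `Y` with a left action of `B` on `Y` which makes `Y` a left `B`-module monoid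
and a left `B`-module comonoid: all four structure morphisms of `Y` are `B`-linear. -/
structure ActBimon where
  B : M
  Y : M
  [bimonB : BimonObj B]
  [bimonY : BimonObj Y]
  l : B ⊗ Y ⟶ Y
  one_act : η[B] ▷ Y ≫ l = (λ_ Y).hom
  mul_act : μ[B] ▷ Y ≫ l = (α_ B B Y).hom ≫ B ◁ l ≫ l
  act_mul : B ◁ μ[Y] ≫ l = diagAct l l ≫ μ[Y]
  act_one : B ◁ η[Y] ≫ l = trivAct B ≫ η[Y]
  act_comul : l ≫ Δ[Y] = B ◁ Δ[Y] ≫ diagAct l l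
  act_counit : l ≫ ε[Y] = B ◁ ε[Y] ≫ trivAct B

namespace ActBimon

attribute [instance] bimonB bimonY

/-- Morphisms are pairs of bimonoid morphisms compatible with the actions. -/
@[ext]
structure Hom (D D' : ActBimon M) where
  b : D.B ⟶ D'.B
  y : D.Y ⟶ D'.Y
  [bimon_b : IsBimonHom b]
  [bimon_y : IsBimonHom y]
  comm_l : (b ⊗ₘ y) ≫ D'.l = D.l ≫ y

attribute [instance] Hom.bimon_b Hom.bimon_y

instance : Category (ActBimon M) where
  Hom := Hom
  id D :=
    { b := 𝟙 D.B
      y := 𝟙 D.Y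
      comm_l := by simp }
  comp {D D' D''} f g :=
    { b := f.b ≫ g.b
      y := f.y ≫ g.y
      comm_l := by
        rw [← tensorHom_comp_tensorHom, Category.assoc, g.comm_l, ← Category.assoc, f.comm_l,
          Category.assoc] }
  id_comp f := Hom.ext (Category.id_comp f.b) (Category.id_comp f.y)
  comp_id f := Hom.ext (Category.comp_id f.b) (Category.comp_id f.y)
  assoc f g h := Hom.ext (Category.assoc f.b g.b h.b) (Category.assoc f.y g.y h.y)

/-- The distributive law `x = l1.1c.δ1` from `B ⊗ Y` to `Y ⊗ B` induced by the action. -/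
def distr (D : ActBimon M) : D.B ⊗ D.Y ⟶ D.Y ⊗ D.B :=
  Δ[D.B] ▷ D.Y ≫ (α_ D.B D.B D.Y).hom ≫ D.B ◁ (β_ D.B D.Y).hom ≫
    (α_ D.B D.Y D.B).inv ≫ D.l ▷ D.B

/-- The multiplication `mm.1x1` of the smash product `Y ⊗ B`. -/
def smashMul (D : ActBimon M) : (D.Y ⊗ D.B) ⊗ (D.Y ⊗ D.B) ⟶ D.Y ⊗ D.B :=
  (α_ D.Y D.B (D.Y ⊗ D.B)).hom ≫
    D.Y ◁ ((α_ D.B D.Y D.B).inv ≫ D.distr ▷ D.B ≫ (α_ D.Y D.B D.B).hom) ≫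
      (α_ D.Y D.Y (D.B ⊗ D.B)).inv ≫ (μ[D.Y] ⊗ₘ μ[D.B])

variable (M) in
/-- Actions of cocommutative bimonoids. -/
def cocomm : ObjectProperty (ActBimon M) :=
  fun D => IsCommComonObj D.B

variable (M) in
/-- Actions of cocommutative Hopf monoids on bimonoids. -/
def cocommHopfActing : ObjectProperty (ActBimon M) :=
  fun D => IsCommComonObj D.B ∧ IsHopf D.B

variable (M) in
/-- Actions of cocommutative Hopf monoids on cocommutative Hopf monoids. -/
def cocommHopf : ObjectProperty (ActBimon M) :=
  fun D => (IsCommComonObj D.B ∧ IsHopf D.B) ∧ (IsCommComonObj D.Y ∧ IsHopf D.Y)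

end ActBimon

/-- An identification of the action `D` with the one obtained from the split epimorphism `X`: the
acting bimonoid is `B`, the bimonoid acted on is `A □_B I` with the bimonoid structure for which
`j` is a bimonoid morphism, and the distributive law of the action satisfies `q.x = m.ij`. -/
structure CotensorIso [HasEqualizers M] (X : SplitEpiBimon M) (D : ActBimon M) where
  isoB : D.B ≅ X.B
  isoY : D.Y ≅ X.cotensor
  bimon_isoB : IsBimonHom isoB.hom
  bimon_isoY : IsBimonHom (isoY.hom ≫ X.j)
  act : D.distr ≫ (isoY.hom ⊗ₘ isoB.hom) ≫ X.q =
    (isoB.hom ⊗ₘ isoY.hom) ≫ (X.i ⊗ₘ X.j) ≫ μ[X.A]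

/-- An identification of the split epimorphism `X` with the one obtained from the action `D`:
`B ⟶ Y ⊗ B ⟶ B` with inclusion `u1` and projection `ε1`, where `Y ⊗ B` carries the smash product
multiplication, the unit `uu` and the tensor product comonoid structure. -/
structure SmashIso (D : ActBimon M) (X : SplitEpiBimon M) where
  isoB : X.B ≅ D.B
  isoA : X.A ≅ D.Y ⊗ D.B
  bimon_isoB : IsBimonHom isoB.hom
  comon_isoA : IsComonHom isoA.hom
  one_isoA : η[X.A] ≫ isoA.hom = (λ_ (𝟙_ M)).inv ≫ (η[D.Y] ⊗ₘ η[D.B])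
  mul_isoA : μ[X.A] ≫ isoA.hom = (isoA.hom ⊗ₘ isoA.hom) ≫ D.smashMul
  comm_i : X.i ≫ isoA.hom = isoB.hom ≫ (λ_ D.B).inv ≫ η[D.Y] ▷ D.B
  comm_s : X.s ≫ isoB.hom = isoA.hom ≫ ε[D.Y] ▷ D.B ≫ (λ_ D.B).hom

end BimonSplit

end

open BimonSplit

/-!
A split epimorphism `s : A ⟶ B` of bimonoids with section `i` is compared with a smash product
`Y ⊗ B`, where `Y = A □_B I`, through `q = m.ji`. Formulas such as `m.ji` are read from right to
left.

Two principles replace most diagrammatic computations. The first is `comonHom_ext`: comonoid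
morphisms into a tensor product `Y ⊗ B` of comonoids agree as soon as their composites with the
projections `1ε` and `ε1` agree. It applies because the relevant maps (`q`, the action, and, by
cocommutativity of `B`, the distributive law and the multiplication of the smash product) are
comonoid morphisms. The second is the convolution product `⋆`: morphisms into a bimonoid are
multiplied pointwise, precomposition with comonoid morphisms and postcomposition with monoid
morphisms preserve products, and inverses are unique.

*The cotensor product.* The condition `c.s1.δ = 1s.δ` makes the comultiplication of `A` restrict to
`A □_B I` in both legs (`CocommAlong.exists_comul`); equalizers being preserved by tensoring, `j`
stays monic after tensoring, and `A □_B I` inherits the bimonoid structure of `A`.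

*Invertibility of `q`.* If `B` has an antipode `z`, then `π = 1 ⋆ i.z.s` satisfies the equation
defining the cotensor product (`conv_antipode_coact`), so it factors through `j`, and `(π ⊗ s).δ` is
inverse to `q` because `(π ⋆ i.s) = 1` and `π.q = j.1ε` (`exists_inverse_q`).

*From split epimorphisms to actions.* If `q` is invertible, then `A` projects onto `Y`, and `B` acts
on `Y` by multiplying in `A` and projecting. Checking `q.x = m.ij` on the two projections
(`distrib_act_q`) turns the axioms of an action into associativity in `A`, and shows that `q` is
multiplicative for the smash product (`smash_act_q`). A morphism of split epimorphisms is thus the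
same as a morphism of actions: the functor `toActFunctor` is full and faithful.

*From actions to split epimorphisms.* For cocommutative `B` the smash product is a bimonoid. Its
multiplication followed by `1ε` is the action of `Y ⊗ B` on `Y`, which reduces associativity to
`smash_smashAct`. Any split epimorphism isomorphic to it has `Y` as its cotensor product, has
invertible `q`, and induces the given action (`SmashIso.toCotensor_act`), so `toActFunctor` is
essentially surjective.

*Restrictions.* Full subcategories correspond because antipodes and cocommutativity transport along
isomorphisms, restrict from `A` to `A □_B I` (`isHopf_cotensor`, `isCommComonObj_of_mono`), and pass
from `A □_B I` and `B` to `A ≅ (A □_B I) ⊗ B` (`isHopf_A`).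
-/

set_option linter.unusedSectionVars false

noncomputable section

namespace BimonSplit

variable {M : Type u} [Category.{v} M] [MonoidalCategory M] [SymmetricCategory M]

/-! ### Morphisms of comonoids -/

section ComonHom

attribute [local instance] ComonObj.instTensorUnit

variable {A B C D : M} [ComonObj A] [ComonObj B] [ComonObj C] [ComonObj D]

instance isComonHom_tensorHom (f : A ⟶ B) (g : C ⟶ D) [IsComonHom f] [IsComonHom g] :
    IsComonHom (f ⊗ₘ g) := by
  let f' : Comon.mk A ⟶ Comon.mk B := Comon.Hom.mk f
  let g' : Comon.mk C ⟶ Comon.mk D := Comon.Hom.mk g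
  have h := (f' ⊗ₘ g').isComonHom_hom
  rwa [Comon.monoidal_tensorHom_hom] at h

instance isComonHom_whiskerRight (f : A ⟶ B) [IsComonHom f] : IsComonHom (f ▷ C) := by
  rw [← tensorHom_id]; infer_instance

instance isComonHom_whiskerLeft (f : A ⟶ B) [IsComonHom f] : IsComonHom (C ◁ f) := by
  rw [← id_tensorHom]; infer_instance

instance isComonHom_associator_hom : IsComonHom (α_ A B C).hom := by
  have h : IsComonHom (𝟙 (A ⊗ B) ▷ C ≫ (α_ A B C).hom ≫ A ◁ 𝟙 (B ⊗ C)) :=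
    (α_ (Comon.mk A) (Comon.mk B) (Comon.mk C)).hom.isComonHom_hom
  simpa using h

instance isComonHom_leftUnitor_hom : IsComonHom (λ_ A).hom where
  hom_counit := by simp [MonoidalCategory.tensorHom_def']
  hom_comul := by
    rw [Comon.tensorObj_comul, ComonObj.instTensorUnit_comul, MonoidalCategory.tensorHom_def',
      Category.assoc, Category.assoc, ← tensor_left_unitality, leftUnitor_naturality]

instance isComonHom_rightUnitor_hom : IsComonHom (ρ_ A).hom where
  hom_counit := by simp [MonoidalCategory.tensorHom_def, unitors_equal]
  hom_comul := by
    rw [Comon.tensorObj_comul, ComonObj.instTensorUnit_comul, MonoidalCategory.tensorHom_def,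
      Category.assoc, Category.assoc, ← tensor_right_unitality, rightUnitor_naturality]

instance isComonHom_counit : IsComonHom ε[A] where
  hom_counit := by simp
  hom_comul := by
    rw [ComonObj.counit_comul_hom, ComonObj.instTensorUnit_comul]

lemma tensorμ_comp_braiding (X Y : M) :
    tensorμ X Y X Y ≫ (β_ (X ⊗ X) (Y ⊗ Y)).hom =
      ((β_ X Y).hom ⊗ₘ (β_ X Y).hom) ≫ tensorμ Y X Y X := by
  simp only [tensorμ, Category.assoc,
    BraidedCategory.braiding_tensor_right_hom, BraidedCategory.braiding_tensor_left_hom,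
    comp_whiskerRight, whisker_assoc, whiskerLeft_comp, pentagon_assoc,
    pentagon_inv_hom_hom_hom_inv_assoc, Iso.inv_hom_id_assoc, whiskerLeft_hom_inv_assoc]
  slice_lhs 3 4 =>
    rw [← whiskerLeft_comp, ← comp_whiskerRight, SymmetricCategory.symmetry]
  simp only [id_whiskerRight, whiskerLeft_id, Category.id_comp, Category.assoc, pentagon_inv_assoc,
    Iso.hom_inv_id_assoc]
  slice_lhs 1 2 =>
    rw [← associator_inv_naturality_left]
  slice_lhs 2 3 =>
    rw [Iso.inv_hom_id]
  rw [Category.id_comp]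
  slice_lhs 2 3 =>
    rw [← associator_naturality_right]
  slice_lhs 1 2 =>
    rw [← MonoidalCategory.tensorHom_def]
  simp only [Category.assoc]

lemma tensorδ_eq_tensorμ (X₁ X₂ Y₁ Y₂ : M) :
    tensorδ X₁ X₂ Y₁ Y₂ = tensorμ X₁ Y₁ X₂ Y₂ := by
  simp only [tensorδ, tensorμ, SymmetricCategory.braiding_swap_eq_inv_braiding]

lemma tensorμ_braiding (A B : M) :
    tensorμ A A B B ≫ ((β_ A B).hom ⊗ₘ (β_ A B).hom) =
      (β_ (A ⊗ A) (B ⊗ B)).hom ≫ tensorμ B B A A := by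
  rw [← tensorδ_eq_tensorμ, ← tensorδ_eq_tensorμ,
    ← Category.comp_id (tensorδ A B A B ≫ _), ← tensorμ_tensorδ B A B A, Category.assoc,
    ← reassoc_of% (tensorμ_comp_braiding A B), tensorδ_tensorμ_assoc]

instance isComonHom_braiding : IsComonHom (β_ A B).hom where
  hom_counit := by
    rw [Comon.tensorObj_counit, Comon.tensorObj_counit,
      ← BraidedCategory.braiding_naturality_assoc, braiding_leftUnitor, unitors_equal]
  hom_comul := by
    rw [Comon.tensorObj_comul, Comon.tensorObj_comul, ← BraidedCategory.braiding_naturality_assoc,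
      Category.assoc, tensorμ_braiding]

/-- The comultiplication of a cocommutative comonoid is a comonoid morphism: the dual of the fact
that the multiplication of a commutative monoid is a monoid morphism. -/
instance isComonHom_comul [IsCommComonObj A] : IsComonHom Δ[A] where
  hom_counit := by
    rw [Comon.tensorObj_counit, ComonObj.comul_counit_hom_assoc, unitors_equal]
    simp
  hom_comul := by
    rw [Comon.tensorObj_comul]
    let _ : MonObj (Opposite.op A) := Comon.ComonToMonOpOpObjMon (Comon.mk A)
    have : IsCommMonObj (Opposite.op A) :=
      ⟨Quiver.Hom.unop_inj (IsCommComonObj.comul_comm A)⟩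
    have h := MonObj.mul_mul_mul_comm (Opposite.op A)
    have e : (tensorμ (Opposite.op A) (Opposite.op A) (Opposite.op A) (Opposite.op A)).unop =
      tensorμ A A A A := by simp [tensorμ]
    have h' : (Δ[A] ≫ (Δ[A] ⊗ₘ Δ[A])) ≫ (tensorμ (Opposite.op A) (Opposite.op A)
        (Opposite.op A) (Opposite.op A)).unop = Δ[A] ≫ (Δ[A] ⊗ₘ Δ[A]) :=
      congrArg Quiver.Hom.unop h
    rw [e, Category.assoc] at h'
    exact h'

end ComonHom

/-! ### Projections from and inclusions into a tensor product -/

section Proj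

/-- The projection `1ε : Y ⊗ B ⟶ Y` of a tensor product onto its first factor, given by the counit
of the second one. -/
def projL (Y B : M) [ComonObj B] : Y ⊗ B ⟶ Y := Y ◁ ε[B] ≫ (ρ_ Y).hom

/-- The projection `ε1 : Y ⊗ B ⟶ B` of a tensor product onto its second factor. -/
def projR (Y B : M) [ComonObj Y] : Y ⊗ B ⟶ B := ε[Y] ▷ B ≫ (λ_ B).hom

/-- The inclusion `1u : Y ⟶ Y ⊗ B` of the first factor, given by the unit of the second one. -/
def inclL (Y B : M) [MonObj B] : Y ⟶ Y ⊗ B := (ρ_ Y).inv ≫ Y ◁ η[B]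

/-- The inclusion `u1 : B ⟶ Y ⊗ B` of the second factor. -/
def inclR (Y B : M) [MonObj Y] : B ⟶ Y ⊗ B := (λ_ B).inv ≫ η[Y] ▷ B

variable {A B C Y : M}

attribute [local instance] ComonObj.instTensorUnit in
instance isComonHom_projL [ComonObj Y] [ComonObj B] : IsComonHom (projL Y B) :=
  inferInstanceAs (IsComonHom (Y ◁ ε[B] ≫ (ρ_ Y).hom))

attribute [local instance] ComonObj.instTensorUnit in
instance isComonHom_projR [ComonObj Y] [ComonObj B] : IsComonHom (projR Y B) :=
  inferInstanceAs (IsComonHom (ε[Y] ▷ B ≫ (λ_ B).hom))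

lemma isMonHom_unit [MonObj B] : IsMonHom η[B] where
  one_hom := by simp
  mul_hom := by
    rw [MonObj.one_mul_hom]
    simp

instance isMonHom_inclL [MonObj Y] [MonObj B] : IsMonHom (inclL Y B) :=
  have : IsMonHom η[B] := isMonHom_unit
  inferInstanceAs (IsMonHom ((ρ_ Y).inv ≫ Y ◁ η[B]))

instance isMonHom_inclR [MonObj Y] [MonObj B] : IsMonHom (inclR Y B) :=
  have : IsMonHom η[Y] := isMonHom_unit
  inferInstanceAs (IsMonHom ((λ_ B).inv ≫ η[Y] ▷ B))

lemma tensorμ_unit_unit (Y B : M) :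
    tensorμ Y (𝟙_ M) (𝟙_ M) B = 𝟙 _ := by
  have h : (β_ (𝟙_ M) (𝟙_ M)).hom = 𝟙 _ := by
    rw [braiding_tensorUnit_left, ← unitors_inv_equal, Iso.hom_inv_id]
  rw [tensorμ, h]
  simp

/-- A tensor product of comonoids is recovered from its two projections. -/
lemma comul_projL_projR [ComonObj Y] [ComonObj B] :
    Δ[Y ⊗ B] ≫ (projL Y B ⊗ₘ projR Y B) = 𝟙 (Y ⊗ B) := by
  have h := tensorμ_natural (𝟙 Y) ε[Y] ε[B] (𝟙 B)
  rw [tensorμ_unit_unit, Category.comp_id] at h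
  rw [Comon.tensorObj_comul, projL, projR, ← tensorHom_comp_tensorHom, ← id_tensorHom,
    ← tensorHom_id, Category.assoc, ← reassoc_of% h]
  simp

/-- A tensor product of monoids is generated by its two factors. -/
lemma inclL_inclR_mul [MonObj Y] [MonObj B] :
    (inclL Y B ⊗ₘ inclR Y B) ≫ μ[Y ⊗ B] = 𝟙 (Y ⊗ B) := by
  have h := tensorμ_natural (𝟙 Y) η[B] η[Y] (𝟙 B)
  rw [tensorμ_unit_unit, Category.id_comp] at h
  rw [MonObj.tensorObj.mul_def, inclL, inclR, ← tensorHom_comp_tensorHom, ← id_tensorHom,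
    ← tensorHom_id, Category.assoc, reassoc_of% h,
    id_tensorHom, tensorHom_id, tensorHom_comp_tensorHom, tensorHom_comp_tensorHom,
    MonObj.mul_one, MonObj.one_mul, Iso.inv_hom_id, Iso.inv_hom_id, id_tensorHom_id]

@[simp]
lemma tensorHom_projL [ComonObj Y] [ComonObj B] [ComonObj C] (f : A ⟶ Y) (g : C ⟶ B)
    [IsComonHom g] : (f ⊗ₘ g) ≫ projL Y B = projL A C ≫ f := by
  rw [projL, projL, MonoidalCategory.tensorHom_def, Category.assoc, ← whiskerLeft_comp_assoc,
    IsComonHom.hom_counit, ← whisker_exchange_assoc]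
  simp

@[simp]
lemma tensorHom_projR [ComonObj Y] [ComonObj A] (f : A ⟶ Y) (g : C ⟶ B)
    [IsComonHom f] : (f ⊗ₘ g) ≫ projR Y B = projR A C ≫ g := by
  rw [projR, projR, MonoidalCategory.tensorHom_def', Category.assoc, ← comp_whiskerRight_assoc,
    IsComonHom.hom_counit, whisker_exchange_assoc]
  simp

@[simp]
lemma whiskerRight_projL [ComonObj B] (f : A ⟶ Y) :
    f ▷ B ≫ projL Y B = projL A B ≫ f := by
  simp [projL, ← whisker_exchange_assoc]

@[simp]
lemma whiskerLeft_projL [ComonObj B] [ComonObj C] (g : C ⟶ B) [IsComonHom g] :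
    Y ◁ g ≫ projL Y B = projL Y C := by
  simp [projL, ← whiskerLeft_comp_assoc]

@[simp]
lemma whiskerLeft_projR [ComonObj Y] (f : A ⟶ B) :
    Y ◁ f ≫ projR Y B = projR Y A ≫ f := by
  simp [projR, whisker_exchange_assoc]

@[simp]
lemma whiskerRight_projR [ComonObj Y] [ComonObj A] (f : A ⟶ Y) [IsComonHom f] :
    f ▷ B ≫ projR Y B = projR A B := by
  simp [projR, ← comp_whiskerRight_assoc]

@[simp]
lemma comul_projR [ComonObj Y] : Δ[Y] ≫ projR Y Y = 𝟙 Y := by simp [projR]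

@[simp]
lemma inclL_projL [BimonObj B] : inclL Y B ≫ projL Y B = 𝟙 Y := by
  simp [inclL, projL, ← whiskerLeft_comp_assoc]

@[simp]
lemma inclR_projR [BimonObj Y] : inclR Y B ≫ projR Y B = 𝟙 B := by
  simp [inclR, projR, ← comp_whiskerRight_assoc]

lemma inclL_projR [ComonObj Y] [MonObj B] : inclL Y B ≫ projR Y B = ε[Y] ≫ η[B] := by
  simp [inclL, projR, whisker_exchange_assoc, ← unitors_inv_equal]

lemma inclR_projL [MonObj Y] [ComonObj B] : inclR Y B ≫ projL Y B = ε[B] ≫ η[Y] := by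
  simp [inclR, projL, ← whisker_exchange_assoc, unitors_inv_equal]

/-- A comonoid morphism into a tensor product is rebuilt from its composites with the two
projections. -/
lemma comonHom_eq_comul_projs [ComonObj C] [ComonObj Y] [ComonObj B] (f : C ⟶ Y ⊗ B)
    [IsComonHom f] : f = Δ[C] ≫ ((f ≫ projL Y B) ⊗ₘ (f ≫ projR Y B)) := by
  rw [← tensorHom_comp_tensorHom, ← IsComonHom.hom_comul_assoc, comul_projL_projR,
    Category.comp_id]

/-- The main tool for verifying identities between morphisms into `Y ⊗ B`: comonoid morphisms are
compared by their composites with the two projections. -/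
lemma comonHom_ext [ComonObj C] [ComonObj Y] [ComonObj B] {f g : C ⟶ Y ⊗ B}
    [IsComonHom f] [IsComonHom g] (hL : f ≫ projL Y B = g ≫ projL Y B)
    (hR : f ≫ projR Y B = g ≫ projR Y B) : f = g := by
  rw [comonHom_eq_comul_projs f, comonHom_eq_comul_projs g, hL, hR]

end Proj

/-! ### Convolution -/

section Convolution

/-- The convolution product of two morphisms from a comonoid to a monoid. -/
def conv {C A : M} [ComonObj C] [MonObj A] (f g : C ⟶ A) : C ⟶ A := Δ[C] ≫ (f ⊗ₘ g) ≫ μ[A]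

/-- The convolution product of two morphisms from a comonoid to a monoid. -/
infixl:70 " ⋆ " => conv

variable {C C' A A' B : M} [ComonObj C] [ComonObj C'] [MonObj A] [MonObj A'] [MonObj B]

lemma conv_eq_mul (f g : C ⟶ A) : f ⋆ g = ((show Conv C A from f) * (show Conv C A from g)) := by
  rw [Conv.mul_eq, conv, MonoidalCategory.tensorHom_def, Category.assoc]

lemma conv_assoc (f g h : C ⟶ A) : f ⋆ g ⋆ h = f ⋆ (g ⋆ h) := by
  rw [conv_eq_mul, conv_eq_mul, conv_eq_mul, conv_eq_mul]
  exact mul_assoc (G := Conv C A) f g h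

@[simp]
lemma unit_conv (f : C ⟶ A) : (ε[C] ≫ η[A]) ⋆ f = f := by
  rw [conv_eq_mul]
  exact one_mul (M := Conv C A) f

@[simp]
lemma conv_unit (f : C ⟶ A) : f ⋆ (ε[C] ≫ η[A]) = f := by
  rw [conv_eq_mul]
  exact mul_one (M := Conv C A) f

lemma comp_conv (k : C' ⟶ C) [IsComonHom k] (f g : C ⟶ A) : k ≫ (f ⋆ g) = (k ≫ f) ⋆ (k ≫ g) := by
  simp [conv]

lemma conv_comp (f g : C ⟶ A) (h : A ⟶ A') [IsMonHom h] : (f ⋆ g) ≫ h = (f ≫ h) ⋆ (g ≫ h) := by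
  simp [conv]

/-- A left and a right convolution inverse of the same morphism agree. -/
lemma eq_of_conv_eq_unit {f g h : C ⟶ A} (hf : f ⋆ g = ε[C] ≫ η[A]) (hh : g ⋆ h = ε[C] ≫ η[A]) :
    f = h := by
  rw [← conv_unit f, ← hh, ← conv_assoc, hf, unit_conv]

/-- The convolution product of morphisms into the two factors of a tensor product. -/
lemma inclL_conv_inclR (f : C ⟶ A) (g : C ⟶ B) :
    (f ≫ inclL A B) ⋆ (g ≫ inclR A B) = Δ[C] ≫ (f ⊗ₘ g) := by
  rw [conv, ← tensorHom_comp_tensorHom, Category.assoc, inclL_inclR_mul, Category.comp_id]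

/-- A comonoid morphism from `C` followed by an antipode and a monoid morphism is a convolution
inverse of the composite without the antipode. -/
lemma IsAntipode.conv_right {H : M} [BimonObj H] {z : H ⟶ H} (hz : IsAntipode H z) (k : C ⟶ H)
    [IsComonHom k] (h : H ⟶ A) [IsMonHom h] : (k ≫ h) ⋆ (k ≫ z ≫ h) = ε[C] ≫ η[A] := by
  have e : 𝟙 H ⋆ z = ε[H] ≫ η[H] := by rw [conv, id_tensorHom, hz.right]
  have e' : h ⋆ (z ≫ h) = ε[H] ≫ η[A] := by
    have := conv_comp (𝟙 H) z h
    rw [e, Category.id_comp, Category.assoc, IsMonHom.one_hom] at this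
    exact this.symm
  rw [← comp_conv, e', IsComonHom.hom_counit_assoc]

lemma IsAntipode.conv_left {H : M} [BimonObj H] {z : H ⟶ H} (hz : IsAntipode H z) (k : C ⟶ H)
    [IsComonHom k] (h : H ⟶ A) [IsMonHom h] : (k ≫ z ≫ h) ⋆ (k ≫ h) = ε[C] ≫ η[A] := by
  have e : z ⋆ 𝟙 H = ε[H] ≫ η[H] := by rw [conv, tensorHom_id, hz.left]
  have e' : (z ≫ h) ⋆ h = ε[H] ≫ η[A] := by
    have := conv_comp z (𝟙 H) h
    rw [e, Category.id_comp, Category.assoc, IsMonHom.one_hom] at this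
    exact this.symm
  rw [← comp_conv, e', IsComonHom.hom_counit_assoc]

lemma isHopf_of_conv {H : M} [BimonObj H] {z : H ⟶ H} (hl : z ⋆ 𝟙 H = ε[H] ≫ η[H])
    (hr : 𝟙 H ⋆ z = ε[H] ≫ η[H]) : IsHopf H :=
  ⟨z, by rwa [conv, tensorHom_id] at hl, by rwa [conv, id_tensorHom] at hr⟩

end Convolution

/-! ### The cotensor product as a bimonoid -/

section Bimon

attribute [local instance] ComonObj.instTensorUnit

variable {A B : M} [BimonObj A] [BimonObj B]

instance isMonHom_comul : IsMonHom Δ[A] where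
  one_hom := BimonObj.one_comul A
  mul_hom := by rw [BimonObj.mul_comul, MonObj.tensorObj.mul_def]

instance isComonHom_mul : IsComonHom μ[A] where
  hom_counit := by rw [Bimon.mul_counit, Comon.tensorObj_counit]
  hom_comul := by rw [BimonObj.mul_comul, Comon.tensorObj_comul, Category.assoc]

instance isComonHom_one : IsComonHom η[A] where
  hom_counit := BimonObj.one_counit A
  hom_comul := Bimon.one_comul A

instance isComonHom_inclL (Y : M) [ComonObj Y] : IsComonHom (inclL Y B) :=
  inferInstanceAs (IsComonHom ((ρ_ Y).inv ≫ Y ◁ η[B]))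

instance isComonHom_inclR (Y : M) [ComonObj Y] : IsComonHom (inclR B Y) :=
  inferInstanceAs (IsComonHom ((λ_ Y).inv ≫ η[B] ▷ Y))

end Bimon

namespace SplitEpiBimon

section Cotensor

variable [HasEqualizers M] (X : SplitEpiBimon M)

/-- The right coaction `1s.δ` of `B` on `A`. -/
def coact : X.A ⟶ X.A ⊗ X.B := Δ[X.A] ≫ X.A ◁ X.s

instance isMonHom_coact : IsMonHom X.coact :=
  inferInstanceAs (IsMonHom (Δ[X.A] ≫ X.A ◁ X.s))

lemma j_coact : X.j ≫ X.coact = X.j ≫ inclL X.A X.B := equalizer.condition _ _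

instance mono_j : Mono X.j := inferInstanceAs (Mono (equalizer.ι _ _))

/-- Morphisms equalizing the coaction and `1u` factor through `A □_B I`. -/
def lift {W : M} (f : W ⟶ X.A) (h : f ≫ X.coact = f ≫ inclL X.A X.B) : W ⟶ X.cotensor :=
  equalizer.lift f h

@[simp]
lemma lift_j {W : M} (f : W ⟶ X.A) (h : f ≫ X.coact = f ≫ inclL X.A X.B) :
    X.lift f h ≫ X.j = f := equalizer.lift_ι _ _

lemma j_s' : X.j ≫ X.s = X.j ≫ ε[X.A] ≫ η[X.B] := by
  have h := congrArg (· ≫ projR X.A X.B) X.j_coact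
  simpa [coact, inclL_projR, reassoc_of% (comul_projR (Y := X.A))] using h

lemma isLimit_fork_j : Nonempty (IsLimit (Fork.ofι X.j X.j_coact)) :=
  ⟨equalizerIsEqualizer _ _⟩

instance : MonObj X.cotensor where
  one := X.lift η[X.A] (by simp)
  mul := X.lift ((X.j ⊗ₘ X.j) ≫ μ[X.A]) (by simp [j_coact])
  one_mul := by
    rw [← cancel_mono X.j, Category.assoc, lift_j, ← tensorHom_id, tensorHom_comp_tensorHom_assoc]
    simp
  mul_one := by
    rw [← cancel_mono X.j, Category.assoc, lift_j, ← id_tensorHom, tensorHom_comp_tensorHom_assoc]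
    simp
  mul_assoc := by
    have h := X.lift_j ((X.j ⊗ₘ X.j) ≫ μ[X.A]) (by simp [j_coact])
    generalize X.lift ((X.j ⊗ₘ X.j) ≫ μ[X.A]) _ = m at h ⊢
    rw [← cancel_mono X.j]
    simp only [Category.assoc, h]
    rw [← tensorHom_id, ← id_tensorHom, tensorHom_comp_tensorHom_assoc,
      tensorHom_comp_tensorHom_assoc, h]
    rw [Category.id_comp, ← Category.comp_id X.j, ← tensorHom_comp_tensorHom, tensorHom_id,
      Category.assoc, MonObj.mul_assoc, associator_naturality_assoc, ← id_tensorHom,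
      tensorHom_comp_tensorHom_assoc]
    simp only [Category.comp_id]

instance isMonHom_j : IsMonHom X.j where
  one_hom := X.lift_j _ _
  mul_hom := X.lift_j _ _

lemma isMonHom_of_comp_j {W : M} [MonObj W] (f : W ⟶ X.cotensor) [IsMonHom (f ≫ X.j)] :
    IsMonHom f where
  one_hom := by
    rw [← cancel_mono X.j, Category.assoc, IsMonHom.one_hom, IsMonHom.one_hom]
  mul_hom := by
    rw [← cancel_mono X.j, Category.assoc, IsMonHom.mul_hom, Category.assoc, IsMonHom.mul_hom,
      tensorHom_comp_tensorHom_assoc]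

variable [∀ X : M, PreservesLimitsOfShape WalkingParallelPair (tensorLeft X)]

instance mono_whiskerLeft_j (Z : M) : Mono (Z ◁ X.j) := by
  obtain ⟨hl⟩ := X.isLimit_fork_j
  exact mono_of_isLimit_fork (isLimitForkMapOfIsLimit (tensorLeft Z) X.j_coact hl)

instance mono_whiskerRight_j (Z : M) : Mono (X.j ▷ Z) := by
  have : X.j ▷ Z = (β_ _ _).hom ≫ Z ◁ X.j ≫ (β_ _ _).hom := by simp
  rw [this]
  infer_instance

instance mono_j_tensor_j : Mono (X.j ⊗ₘ X.j) := by
  rw [MonoidalCategory.tensorHom_def]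
  infer_instance

instance mono_j_tensor_j_tensor_j : Mono (X.j ⊗ₘ (X.j ⊗ₘ X.j)) := by
  have h₁ : X.A ◁ X.j ▷ X.cotensor =
      (α_ _ _ _).inv ≫ (X.A ◁ X.j) ▷ X.cotensor ≫ (α_ _ _ _).hom := by
    simp
  have h₂ : (X.A ◁ X.j) ▷ X.cotensor = (β_ _ _).hom ≫ X.cotensor ◁ X.A ◁ X.j ≫
      (β_ _ _).hom := by
    rw [BraidedCategory.braiding_naturality_right, SymmetricCategory.symmetry_assoc]
  have h₃ : X.A ◁ X.A ◁ X.j = (α_ _ _ _).inv ≫ (X.A ⊗ X.A) ◁ X.j ≫ (α_ _ _ _).hom := by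
    simp
  have h₄ : X.cotensor ◁ X.A ◁ X.j =
      (α_ _ _ _).inv ≫ (X.cotensor ⊗ X.A) ◁ X.j ≫ (α_ _ _ _).hom := by
    simp
  rw [MonoidalCategory.tensorHom_def, MonoidalCategory.tensorHom_def, whiskerLeft_comp, h₁, h₂, h₃,
    h₄]
  infer_instance

lemma exists_lift_whiskerLeft {W Z : M} (f : W ⟶ Z ⊗ X.A)
    (h : f ≫ Z ◁ X.coact = f ≫ Z ◁ inclL X.A X.B) : ∃ g, g ≫ Z ◁ X.j = f := by
  obtain ⟨hl⟩ := X.isLimit_fork_j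
  exact ⟨Fork.IsLimit.lift (isLimitForkMapOfIsLimit (tensorLeft Z) X.j_coact hl) f h,
    Fork.IsLimit.lift_ι (isLimitForkMapOfIsLimit (tensorLeft Z) X.j_coact hl)⟩

lemma exists_lift_whiskerRight {W Z : M} (f : W ⟶ X.A ⊗ Z)
    (h : f ≫ X.coact ▷ Z = f ≫ inclL X.A X.B ▷ Z) : ∃ g, g ≫ X.j ▷ Z = f := by
  obtain ⟨g, hg⟩ := X.exists_lift_whiskerLeft (f ≫ (β_ _ _).hom) (Z := Z) (by
    rw [Category.assoc, Category.assoc, ← BraidedCategory.braiding_naturality_left, reassoc_of% h,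
      BraidedCategory.braiding_naturality_left])
  refine ⟨g ≫ (β_ _ _).hom, ?_⟩
  rw [Category.assoc, ← BraidedCategory.braiding_naturality_right, reassoc_of% hg]
  simp

variable {X} in
/-- The comultiplication of `A` restricts to `A □_B I`. -/
lemma CocommAlong.exists_comul (hX : X.CocommAlong) :
    ∃ d : X.cotensor ⟶ X.cotensor ⊗ X.cotensor, d ≫ (X.j ⊗ₘ X.j) = X.j ≫ Δ[X.A] := by
  -- the second leg of the comultiplication lies in the cotensor product by coassociativity
  have h₁ : X.j ≫ Δ[X.A] ≫ X.A ◁ X.coact = X.j ≫ Δ[X.A] ≫ X.A ◁ inclL X.A X.B := by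
    have e₁ : Δ[X.A] ≫ X.A ◁ X.coact = X.coact ≫ Δ[X.A] ▷ X.B ≫ (α_ _ _ _).hom := by
      simp [coact, whisker_exchange_assoc]
    have e₂ : Δ[X.A] ≫ X.A ◁ inclL X.A X.B =
        inclL X.A X.B ≫ Δ[X.A] ▷ X.B ≫ (α_ _ _ _).hom := by
      simp [inclL, whisker_exchange_assoc]
    rw [e₁, e₂, reassoc_of% X.j_coact]
  -- the first leg does because the coaction is also given by the first leg
  have h₂ : X.j ≫ Δ[X.A] ≫ X.coact ▷ X.A = X.j ≫ Δ[X.A] ≫ inclL X.A X.B ▷ X.A := by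
    have hc : Δ[X.A] ≫ X.s ▷ X.A = X.coact ≫ (β_ _ _).hom := by
      rw [coact, ← hX]
      simp
    have e₁ : Δ[X.A] ≫ X.coact ▷ X.A =
        Δ[X.A] ≫ X.A ◁ X.coact ≫ X.A ◁ (β_ _ _).hom ≫ (α_ _ _ _).inv := by
      rw [← whiskerLeft_comp_assoc, ← hc, coact]
      simp
    have e₂ : inclL X.A X.B ▷ X.A =
        X.A ◁ inclL X.A X.B ≫ X.A ◁ (β_ _ _).hom ≫ (α_ _ _ _).inv := by
      rw [← whiskerLeft_comp_assoc, inclL, Category.assoc,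
        BraidedCategory.braiding_naturality_right]
      simp
    rw [e₁, e₂, reassoc_of% h₁]
  obtain ⟨g, hg⟩ := X.exists_lift_whiskerLeft (X.j ≫ Δ[X.A]) (by simpa using h₁)
  obtain ⟨d, hd⟩ := X.exists_lift_whiskerRight g (by
    rw [← cancel_mono (_ ◁ X.j), Category.assoc, Category.assoc, ← whisker_exchange,
      ← whisker_exchange, reassoc_of% hg, reassoc_of% hg]
    exact h₂)
  exact ⟨d, by rw [MonoidalCategory.tensorHom_def, reassoc_of% hd, hg]⟩

variable [hX : Fact X.CocommAlong]

/-- `A □_B I` is a subcomonoid of `A`. -/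
instance : ComonObj X.cotensor where
  counit := X.j ≫ ε[X.A]
  comul := hX.out.exists_comul.choose
  counit_comul := by
    rw [← cancel_mono (_ ◁ X.j), Category.assoc, comp_whiskerRight, Category.assoc,
      ← whisker_exchange, ← MonoidalCategory.tensorHom_def_assoc,
      reassoc_of% hX.out.exists_comul.choose_spec]
    simp
  comul_counit := by
    rw [← cancel_mono (X.j ▷ _), Category.assoc, whiskerLeft_comp, Category.assoc,
      whisker_exchange, ← MonoidalCategory.tensorHom_def'_assoc,
      reassoc_of% hX.out.exists_comul.choose_spec]
    simp
  comul_assoc := by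
    have h := hX.out.exists_comul.choose_spec
    set d := hX.out.exists_comul.choose
    rw [← cancel_mono (X.j ⊗ₘ (X.j ⊗ₘ X.j))]
    simp only [Category.assoc]
    have e₁ : X.cotensor ◁ d ≫ (X.j ⊗ₘ (X.j ⊗ₘ X.j)) = (X.j ⊗ₘ X.j) ≫ X.A ◁ Δ[X.A] := by
      rw [← id_tensorHom, ← id_tensorHom, tensorHom_comp_tensorHom, tensorHom_comp_tensorHom, h]
      simp
    have e₂ : d ▷ X.cotensor ≫ ((X.j ⊗ₘ X.j) ⊗ₘ X.j) = (X.j ⊗ₘ X.j) ≫ Δ[X.A] ▷ X.A := by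
      rw [← tensorHom_id, ← tensorHom_id, tensorHom_comp_tensorHom, tensorHom_comp_tensorHom, h]
      simp
    rw [e₁, ← associator_naturality, reassoc_of% e₂, reassoc_of% h, reassoc_of% h,
      ComonObj.comul_assoc]

instance isComonHom_j : IsComonHom X.j where
  hom_counit := rfl
  hom_comul := hX.out.exists_comul.choose_spec.symm

lemma isComonHom_of_comp_j {W : M} [ComonObj W] (f : W ⟶ X.cotensor) [IsComonHom (f ≫ X.j)] :
    IsComonHom f where
  hom_counit := by
    rw [← IsComonHom.hom_counit X.j, ← Category.assoc, IsComonHom.hom_counit]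
  hom_comul := by
    rw [← cancel_mono (X.j ⊗ₘ X.j), Category.assoc, Category.assoc, ← IsComonHom.hom_comul,
      tensorHom_comp_tensorHom, ← Category.assoc, IsComonHom.hom_comul]

instance : BimonObj X.cotensor where
  mul_comul := by
    have h : μ[X.cotensor] ≫ Δ[X.cotensor] =
        (Δ[X.cotensor] ⊗ₘ Δ[X.cotensor]) ≫ μ[X.cotensor ⊗ X.cotensor] := by
      rw [← cancel_mono (X.j ⊗ₘ X.j), Category.assoc, Category.assoc, ← IsComonHom.hom_comul,
        IsMonHom.mul_hom_assoc, IsMonHom.mul_hom, IsMonHom.mul_hom,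
        tensorHom_comp_tensorHom_assoc, tensorHom_comp_tensorHom_assoc, IsComonHom.hom_comul]
    rw [h, MonObj.tensorObj.mul_def]
  one_comul := by
    rw [← cancel_mono (X.j ⊗ₘ X.j), Category.assoc, ← IsComonHom.hom_comul, IsMonHom.one_hom_assoc,
      IsMonHom.one_hom, IsMonHom.one_hom]
  mul_counit := by
    rw [← IsComonHom.hom_counit X.j, IsMonHom.mul_hom_assoc, Bimon.mul_counit,
      tensorHom_comp_tensorHom_assoc, IsComonHom.hom_counit, Comon.tensorObj_counit]
  one_counit := by
    rw [← IsComonHom.hom_counit X.j, IsMonHom.one_hom_assoc, BimonObj.one_counit]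

instance isBimonHom_j : IsBimonHom X.j where

lemma isBimonHom_of_comp_j {W : M} [BimonObj W] (f : W ⟶ X.cotensor) [IsBimonHom (f ≫ X.j)] :
    IsBimonHom f :=
  { X.isMonHom_of_comp_j f, X.isComonHom_of_comp_j f with }

end Cotensor

/-! ### Invertibility of `q` -/

section Splitting

variable [HasEqualizers M] [∀ X : M, PreservesLimitsOfShape WalkingParallelPair (tensorLeft X)]
  (X : SplitEpiBimon M) [hX : Fact X.CocommAlong]

lemma j_s : X.j ≫ X.s = ε[X.cotensor] ≫ η[X.B] := by
  rw [j_s', ← Category.assoc, IsComonHom.hom_counit]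

instance isComonHom_q : IsComonHom X.q :=
  inferInstanceAs (IsComonHom ((X.j ⊗ₘ X.i) ≫ μ[X.A]))

lemma q_s : X.q ≫ X.s = projR X.cotensor X.B := by
  rw [q, Category.assoc, IsMonHom.mul_hom, tensorHom_comp_tensorHom_assoc, j_s, X.i_s,
    ← Category.id_comp (𝟙 X.B), ← tensorHom_comp_tensorHom, Category.assoc, MonObj.one_mul_hom,
    Category.comp_id, tensorHom_id, projR]

/-- `q` is the convolution product of its restrictions to the two factors. -/
lemma q_eq_conv :
    X.q = (projL X.cotensor X.B ≫ X.j) ⋆ (projR X.cotensor X.B ≫ X.i) := by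
  rw [conv, ← tensorHom_comp_tensorHom, Category.assoc, reassoc_of% comul_projL_projR, q]

lemma comul_lift_q (f : X.A ⟶ X.cotensor) :
    Δ[X.A] ≫ (f ⊗ₘ X.s) ≫ X.q = (f ≫ X.j) ⋆ (X.s ≫ X.i) := by
  rw [q, tensorHom_comp_tensorHom_assoc, conv]

section Antipode

variable {X} {z : X.B ⟶ X.B} (hz : IsAntipode X.B z)

include hz

/-- The morphism `a ↦ a₁ i(z(s(a₂)))` takes values in the cotensor product. -/
lemma conv_antipode_coact :
    (𝟙 X.A ⋆ (X.s ≫ z ≫ X.i)) ≫ X.coact = (𝟙 X.A ⋆ (X.s ≫ z ≫ X.i)) ≫ inclL X.A X.B := by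
  have hc : X.coact = inclL X.A X.B ⋆ (X.s ≫ inclR X.A X.B) := by
    have := inclL_conv_inclR (𝟙 X.A) X.s
    rw [Category.id_comp, id_tensorHom] at this
    exact this.symm
  have hi : X.s ≫ X.i ≫ X.coact =
      (X.s ≫ X.i ≫ inclL X.A X.B) ⋆ (X.s ≫ inclR X.A X.B) := by
    rw [hc, comp_conv, comp_conv, reassoc_of% X.i_s]
  have hinv : X.s ≫ z ≫ X.i ≫ X.coact =
      (X.s ≫ z ≫ inclR X.A X.B) ⋆ (X.s ≫ z ≫ X.i ≫ inclL X.A X.B) := by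
    refine eq_of_conv_eq_unit (hz.conv_left X.s (X.i ≫ X.coact)) ?_
    rw [hi, conv_assoc, ← conv_assoc (X.s ≫ inclR X.A X.B), hz.conv_right, unit_conv,
      hz.conv_right]
  rw [conv_comp, conv_comp, Category.id_comp, Category.id_comp, Category.assoc, Category.assoc,
    hinv, hc, conv_assoc, ← conv_assoc (X.s ≫ inclR X.A X.B), hz.conv_right, unit_conv,
    Category.assoc, Category.assoc]

lemma q_conv_antipode :
    X.q ≫ (𝟙 X.A ⋆ (X.s ≫ z ≫ X.i)) = projL X.cotensor X.B ≫ X.j := by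
  rw [comp_conv, Category.comp_id, reassoc_of% @q_s]
  nth_rw 1 [q_eq_conv]
  rw [conv_assoc, hz.conv_right, conv_unit]

/-- An antipode `z` of `B` makes `q` invertible: the inverse of `q` is `a ↦ π(a₁) ⊗ s(a₂)`,
where `π(a) = a₁ i(z(s(a₂)))`. -/
lemma exists_inverse_q :
    ∃ r : X.A ⟶ X.cotensor ⊗ X.B, X.q ≫ r = 𝟙 _ ∧ r ≫ X.q = 𝟙 _ ∧
        r ≫ X.j ▷ X.B =
          Δ[X.A] ≫ X.A ◁ X.s ≫ X.A ◁ Δ[X.B] ≫ X.A ◁ (z ▷ X.B) ≫ X.A ◁ (X.i ▷ X.B) ≫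
            (α_ X.A X.A X.B).inv ≫ μ[X.A] ▷ X.B := by
  have hp := X.lift_j _ (conv_antipode_coact hz)
  generalize X.lift _ (conv_antipode_coact hz) = p at hp
  refine ⟨Δ[X.A] ≫ (p ⊗ₘ X.s), ?_, ?_, ?_⟩
  · have h : X.q ≫ p = projL X.cotensor X.B := by
      rw [← cancel_mono X.j, Category.assoc, hp, q_conv_antipode hz]
    rw [IsComonHom.hom_comul_assoc, tensorHom_comp_tensorHom, h, q_s, comul_projL_projR]
  · rw [Category.assoc, comul_lift_q, hp, conv_assoc, hz.conv_left, conv_unit]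
  · rw [Category.assoc, ← tensorHom_id, tensorHom_comp_tensorHom, hp, Category.comp_id, conv]
    have e : X.A ◁ X.s ≫ X.A ◁ Δ[X.B] = X.A ◁ Δ[X.A] ≫ X.A ◁ (X.s ⊗ₘ X.s) := by
      rw [← whiskerLeft_comp, IsComonHom.hom_comul, whiskerLeft_comp]
    rw [reassoc_of% e]
    have e' : X.A ◁ (X.s ⊗ₘ X.s) ≫ X.A ◁ (z ▷ X.B) ≫ X.A ◁ (X.i ▷ X.B) ≫ (α_ X.A X.A X.B).inv =
        (α_ X.A X.A X.A).inv ≫ ((𝟙 X.A ⊗ₘ (X.s ≫ z ≫ X.i)) ⊗ₘ X.s) := by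
      rw [← associator_inv_naturality, id_tensorHom, ← whiskerLeft_comp_assoc,
        ← whiskerLeft_comp_assoc, ← tensorHom_id, ← tensorHom_id, tensorHom_comp_tensorHom,
        tensorHom_comp_tensorHom]
      simp
    rw [reassoc_of% e', ← ComonObj.comul_assoc_flip_assoc, ← tensorHom_id, ← tensorHom_id,
      tensorHom_comp_tensorHom, tensorHom_comp_tensorHom]
    simp

lemma isIso_q : IsIso X.q := by
  obtain ⟨r, h₁, h₂, -⟩ := exists_inverse_q hz
  exact ⟨r, h₁, h₂⟩

end Antipode

end Splitting

end SplitEpiBimon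

/-! ### The distributive law induced by an action -/

section Associator

variable {A B C : M}

@[simp]
lemma braiding_projL [ComonObj A] : (β_ A B).hom ≫ projL B A = projR A B := by
  rw [projL, projR, ← BraidedCategory.braiding_naturality_left_assoc, braiding_rightUnitor]

@[simp]
lemma braiding_projR [ComonObj B] : (β_ A B).hom ≫ projR B A = projL A B := by
  rw [projL, projR, ← BraidedCategory.braiding_naturality_right_assoc, braiding_leftUnitor]

@[simp]
lemma associator_hom_projL [ComonObj B] [ComonObj C] :
    (α_ A B C).hom ≫ projL A (B ⊗ C) = projL (A ⊗ B) C ≫ projL A B := by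
  have h : (λ_ (𝟙_ M)).hom = (ρ_ (𝟙_ M)).hom := unitors_equal
  simp [projL, MonoidalCategory.tensorHom_def', h]

@[simp]
lemma associator_inv_projL [ComonObj C] :
    (α_ A B C).inv ≫ projL (A ⊗ B) C = A ◁ projL B C := by
  simp [projL]

@[simp]
lemma associator_hom_projR [ComonObj A] :
    (α_ A B C).hom ≫ projR A (B ⊗ C) = projR A B ▷ C := by
  simp [projR]

@[simp]
lemma associator_inv_projR [ComonObj A] [ComonObj B] :
    (α_ A B C).inv ≫ projR (A ⊗ B) C = projR A (B ⊗ C) ≫ projR B C := by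
  simp [projR, MonoidalCategory.tensorHom_def]

end Associator

lemma tensorHom_mul_assoc {A P Q R : M} [MonObj A] (f : P ⟶ A) (g : Q ⟶ A) (h : R ⟶ A) :
    ((f ⊗ₘ g) ≫ μ[A] ⊗ₘ h) ≫ μ[A] = (α_ P Q R).hom ≫ (f ⊗ₘ (g ⊗ₘ h) ≫ μ[A]) ≫ μ[A] := by
  rw [← Category.comp_id f, ← tensorHom_comp_tensorHom f, Category.assoc,
    ← associator_naturality_assoc,
    id_tensorHom, ← MonObj.mul_assoc, ← tensorHom_id, tensorHom_comp_tensorHom_assoc]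
  simp only [Category.comp_id]

lemma tensorHom_mul_assoc_inv {A P Q R : M} [MonObj A] (f : P ⟶ A) (g : Q ⟶ A) (h : R ⟶ A) :
    (f ⊗ₘ (g ⊗ₘ h) ≫ μ[A]) ≫ μ[A] = (α_ P Q R).inv ≫ ((f ⊗ₘ g) ≫ μ[A] ⊗ₘ h) ≫ μ[A] := by
  rw [tensorHom_mul_assoc, Iso.inv_hom_id_assoc]

section Distrib

variable {B Y V W : M} [BimonObj B]

/-- The morphism `l1.1c.δ1 : B ⊗ Y ⟶ Y ⊗ B` for an arbitrary morphism `l : B ⊗ Y ⟶ Y`. -/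
def distrib (l : B ⊗ Y ⟶ Y) : B ⊗ Y ⟶ Y ⊗ B :=
  Δ[B] ▷ Y ≫ (α_ B B Y).hom ≫ B ◁ (β_ B Y).hom ≫ (α_ B Y B).inv ≫ l ▷ B

/-- The diagonal action applies the distributive law of the first action and then the second
action. -/
lemma diagAct_eq (l : B ⊗ V ⟶ V) (l' : B ⊗ W ⟶ W) :
    diagAct l l' = (α_ B V W).inv ≫ distrib l ▷ W ≫ (α_ V B W).hom ≫ V ◁ l' := by
  simp [diagAct, distrib, tensorμ, MonoidalCategory.tensorHom_def]

@[simp]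
lemma distrib_projL (l : B ⊗ Y ⟶ Y) : distrib l ≫ projL Y B = l := by
  have h' : Δ[B] ▷ Y ≫ (α_ B B Y).hom ≫ B ◁ projR B Y = 𝟙 _ := by
    rw [projR, whiskerLeft_comp, ← associator_naturality_middle_assoc, ← comp_whiskerRight_assoc,
      ComonObj.comul_counit]
    simp
  rw [distrib, Category.assoc, Category.assoc, Category.assoc, Category.assoc, whiskerRight_projL,
    reassoc_of% @associator_inv_projL, ← whiskerLeft_comp_assoc, braiding_projL, reassoc_of% h']

@[simp]
lemma distrib_projR [ComonObj Y] (l : B ⊗ Y ⟶ Y) [IsComonHom l] :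
    distrib l ≫ projR Y B = projL B Y := by
  rw [distrib, Category.assoc, Category.assoc, Category.assoc, Category.assoc, whiskerRight_projR,
    associator_inv_projR, reassoc_of% @whiskerLeft_projR, braiding_projR,
    reassoc_of% @associator_hom_projR,
    ← comp_whiskerRight_assoc, comul_projR, id_whiskerRight, Category.id_comp]

instance isComonHom_distrib [ComonObj Y] [IsCommComonObj B] (l : B ⊗ Y ⟶ Y) [IsComonHom l] :
    IsComonHom (distrib l) :=
  inferInstanceAs (IsComonHom
    (Δ[B] ▷ Y ≫ (α_ B B Y).hom ≫ B ◁ (β_ B Y).hom ≫ (α_ B Y B).inv ≫ l ▷ B))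

/-- Compatibility of an action with the counit, as stated through the trivial action on the unit,
says that the action preserves counits. -/
lemma whiskerLeft_counit_trivAct [ComonObj Y] : B ◁ ε[Y] ≫ trivAct B = ε[B ⊗ Y] := by
  rw [Comon.tensorObj_counit, trivAct, MonoidalCategory.tensorHom_def', Category.assoc]

/-- Compatibility of an action with the comultiplication, as stated through the diagonal action,
says that the action preserves comultiplications. -/
lemma whiskerLeft_comul_diagAct [ComonObj Y] (l : B ⊗ Y ⟶ Y) :
    B ◁ Δ[Y] ≫ diagAct l l = Δ[B ⊗ Y] ≫ (l ⊗ₘ l) := by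
  rw [Comon.tensorObj_comul, diagAct, MonoidalCategory.tensorHom_def' Δ[B], Category.assoc,
    Category.assoc]

end Distrib

namespace ActBimon

variable (D : ActBimon M)

instance isComonHom_l : IsComonHom D.l where
  hom_counit := by rw [D.act_counit, whiskerLeft_counit_trivAct]
  hom_comul := by rw [D.act_comul, whiskerLeft_comul_diagAct]

end ActBimon

/-! ### The action of a split epimorphism -/

namespace SplitEpiBimon

section Action

/-- `B` is a quotient comonoid of `A` on which `c.s1.δ = 1s.δ` becomes cocommutativity. -/
lemma CocommAlong.isCommComonObj {X : SplitEpiBimon M} (hX : X.CocommAlong) :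
    IsCommComonObj X.B where
  comul_comm := by
    have h := X.i ≫= hX =≫ (X.s ▷ X.B)
    simp only [Category.assoc, IsComonHom.hom_comul_assoc] at h
    rw [← tensorHom_id, ← id_tensorHom, ← tensorHom_id, ← BraidedCategory.braiding_naturality,
      tensorHom_comp_tensorHom_assoc, tensorHom_comp_tensorHom_assoc, tensorHom_comp_tensorHom,
      tensorHom_comp_tensorHom] at h
    simpa [X.i_s] using h

variable [HasEqualizers M] [∀ X : M, PreservesLimitsOfShape WalkingParallelPair (tensorLeft X)]
  (X : SplitEpiBimon M) [hX : Fact X.CocommAlong]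

instance : IsCommComonObj X.B := hX.out.isCommComonObj

variable [IsIso X.q]

/-- The projection of `A ≅ (A □_B I) ⊗ B` onto its first factor. -/
def proj : X.A ⟶ X.cotensor := inv X.q ≫ projL X.cotensor X.B

instance isComonHom_proj : IsComonHom X.proj :=
  inferInstanceAs (IsComonHom (inv X.q ≫ projL X.cotensor X.B))

@[simp]
lemma q_proj : X.q ≫ X.proj = projL X.cotensor X.B := by simp [proj]

@[simp]
lemma inv_q_projR : inv X.q ≫ projR X.cotensor X.B = X.s := by
  rw [← q_s, IsIso.inv_hom_id_assoc]

lemma inv_q : inv X.q = Δ[X.A] ≫ (X.proj ⊗ₘ X.s) := by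
  rw [comonHom_eq_comul_projs (inv X.q), inv_q_projR, proj]

@[simp]
lemma inclL_q : inclL X.cotensor X.B ≫ X.q = X.j := by
  rw [inclL, q, Category.assoc, ← id_tensorHom, tensorHom_comp_tensorHom_assoc, IsMonHom.one_hom,
    Category.id_comp, MonObj.mul_one_hom, Iso.inv_hom_id_assoc]

@[simp]
lemma inclR_q : inclR X.cotensor X.B ≫ X.q = X.i := by
  rw [inclR, q, Category.assoc, ← tensorHom_id, tensorHom_comp_tensorHom_assoc, IsMonHom.one_hom,
    Category.id_comp, MonObj.one_mul_hom, Iso.inv_hom_id_assoc]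

@[simp]
lemma j_proj : X.j ≫ X.proj = 𝟙 _ := by
  rw [← inclL_q, Category.assoc, q_proj, inclL_projL]

@[simp]
lemma i_proj : X.i ≫ X.proj = ε[X.B] ≫ η[X.cotensor] := by
  rw [← inclR_q, Category.assoc, q_proj, inclR_projL]

/-- Right multiplication by elements of `B` is not seen by the projection to `A □_B I`. -/
lemma whiskerLeft_i_mul_proj : X.A ◁ X.i ≫ μ[X.A] ≫ X.proj = projL X.A X.B ≫ X.proj := by
  rw [← cancel_epi (X.q ▷ X.B)]
  have h : X.q ▷ X.B ≫ X.A ◁ X.i ≫ μ[X.A] = (α_ _ _ _).hom ≫ X.cotensor ◁ μ[X.B] ≫ X.q := by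
    rw [← MonoidalCategory.tensorHom_def_assoc, q, tensorHom_mul_assoc, ← id_tensorHom,
      tensorHom_comp_tensorHom_assoc, Category.id_comp, IsMonHom.mul_hom]
  rw [reassoc_of% h, q_proj, whiskerLeft_projL, associator_hom_projL,
    reassoc_of% @whiskerRight_projL,
    q_proj]

/-- The product of two elements of `A` only depends, after projecting to `A □_B I`, on the
projection of the second factor. -/
lemma whiskerLeft_proj_j_mul_proj :
    X.A ◁ (X.proj ≫ X.j) ≫ μ[X.A] ≫ X.proj = μ[X.A] ≫ X.proj := by
  rw [← cancel_epi (X.A ◁ X.q)]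
  have h : X.A ◁ X.q ≫ μ[X.A] =
      (α_ _ _ _).inv ≫ (X.A ◁ X.j ≫ μ[X.A]) ▷ X.B ≫ X.A ◁ X.i ≫ μ[X.A] := by
    rw [← MonoidalCategory.tensorHom_def_assoc, q, ← id_tensorHom, ← id_tensorHom,
      tensorHom_mul_assoc_inv]
  rw [reassoc_of% h, whiskerLeft_i_mul_proj, reassoc_of% @whiskerRight_projL,
    reassoc_of% @associator_inv_projL,
    ← whiskerLeft_comp_assoc, reassoc_of% @q_proj, whiskerLeft_comp_assoc, Category.assoc]

/-- The projection to `A □_B I` is linear for left multiplication by elements of `A □_B I`. -/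
lemma whiskerRight_j_mul_proj :
    X.j ▷ X.A ≫ μ[X.A] ≫ X.proj = X.cotensor ◁ X.proj ≫ μ[X.cotensor] := by
  rw [← cancel_epi (X.cotensor ◁ X.q)]
  have h : X.cotensor ◁ X.q ≫ X.j ▷ X.A ≫ μ[X.A] =
      (α_ _ _ _).inv ≫ μ[X.cotensor] ▷ X.B ≫ X.q := by
    rw [← MonoidalCategory.tensorHom_def'_assoc, q, tensorHom_mul_assoc_inv, ← tensorHom_id,
      tensorHom_comp_tensorHom_assoc, Category.id_comp, IsMonHom.mul_hom]
  rw [reassoc_of% h, q_proj, whiskerRight_projL, reassoc_of% @associator_inv_projL,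
    ← whiskerLeft_comp_assoc, q_proj]

/-- The action of `B` on `A □_B I`: multiplication in `A` followed by the projection. -/
def act : X.B ⊗ X.cotensor ⟶ X.cotensor := (X.i ⊗ₘ X.j) ≫ μ[X.A] ≫ X.proj

instance isComonHom_act : IsComonHom X.act :=
  inferInstanceAs (IsComonHom ((X.i ⊗ₘ X.j) ≫ μ[X.A] ≫ X.proj))

/-- The defining property `q.x = m.ij` of the action. Both sides become comonoid morphisms into
`(A □_B I) ⊗ B` after composing with the inverse of `q`. -/
lemma distrib_act_q : distrib X.act ≫ X.q = (X.i ⊗ₘ X.j) ≫ μ[X.A] := by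
  have h : distrib X.act = ((X.i ⊗ₘ X.j) ≫ μ[X.A]) ≫ inv X.q := by
    refine comonHom_ext ?_ ?_
    · rw [distrib_projL, act, proj, Category.assoc, Category.assoc]
    · rw [distrib_projR, Category.assoc, inv_q_projR, Category.assoc, IsMonHom.mul_hom,
        tensorHom_comp_tensorHom_assoc, j_s, i_s,
        ← Category.id_comp (𝟙 X.B), ← tensorHom_comp_tensorHom, Category.assoc,
        MonObj.mul_one_hom, Category.comp_id, id_tensorHom, projL]
  rw [h, Category.assoc, IsIso.inv_hom_id, Category.comp_id]

/-- The action associated with a split epimorphism. -/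
def toAct : ActBimon M where
  B := X.B
  Y := X.cotensor
  l := X.act
  one_act := by
    rw [act, ← tensorHom_id, tensorHom_comp_tensorHom_assoc, IsMonHom.one_hom, Category.id_comp,
      MonObj.one_mul_hom_assoc, j_proj, Category.comp_id]
  mul_act := by
    have h : X.B ◁ X.act ≫ X.act =
        (X.i ⊗ₘ (X.i ⊗ₘ X.j) ≫ μ[X.A]) ≫ X.A ◁ (X.proj ≫ X.j) ≫ μ[X.A] ≫ X.proj := by
      rw [act, ← id_tensorHom, ← id_tensorHom, tensorHom_comp_tensorHom_assoc,
        tensorHom_comp_tensorHom_assoc]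
      simp
    rw [h, whiskerLeft_proj_j_mul_proj, act, ← tensorHom_id, tensorHom_comp_tensorHom_assoc,
      IsMonHom.mul_hom, Category.id_comp, reassoc_of% (tensorHom_mul_assoc X.i X.i X.j)]
  act_mul := by
    have h₁ : X.B ◁ μ[X.cotensor] ≫ X.act =
        (X.i ⊗ₘ (X.j ⊗ₘ X.j) ≫ μ[X.A]) ≫ μ[X.A] ≫ X.proj := by
      rw [act, ← id_tensorHom, tensorHom_comp_tensorHom_assoc, IsMonHom.mul_hom,
        Category.id_comp]
    have h₂ : (X.j ⊗ₘ (X.i ⊗ₘ X.j) ≫ μ[X.A]) ≫ μ[X.A] ≫ X.proj =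
        X.cotensor ◁ X.act ≫ μ[X.cotensor] := by
      rw [MonoidalCategory.tensorHom_def', Category.assoc, whiskerRight_j_mul_proj, act,
        ← whiskerLeft_comp_assoc, Category.assoc]
    rw [diagAct_eq, h₁, reassoc_of% (tensorHom_mul_assoc_inv X.i X.j X.j), ← distrib_act_q,
      ← Category.id_comp X.j, ← tensorHom_comp_tensorHom, q, Category.assoc,
      reassoc_of% (tensorHom_mul_assoc X.j X.i X.j), h₂, tensorHom_id]
    simp only [Category.assoc]
  act_one := by
    rw [act, ← id_tensorHom, tensorHom_comp_tensorHom_assoc, IsMonHom.one_hom, Category.id_comp,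
      MonObj.mul_one_hom_assoc, i_proj, trivAct]
    simp [unitors_equal]
  act_comul := by rw [IsComonHom.hom_comul, whiskerLeft_comul_diagAct]
  act_counit := by rw [IsComonHom.hom_counit, whiskerLeft_counit_trivAct]

end Action

end SplitEpiBimon

/-! ### Morphisms of actions and the smash product -/

section Incl

variable {A B C Y : M}

@[simp]
lemma inclL_tensorHom [MonObj B] [MonObj C] (f : A ⟶ Y) (g : B ⟶ C) [IsMonHom g] :
    inclL A B ≫ (f ⊗ₘ g) = f ≫ inclL Y C := by
  rw [inclL, inclL, Category.assoc, MonoidalCategory.tensorHom_def', ← whiskerLeft_comp_assoc,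
    IsMonHom.one_hom, whisker_exchange, rightUnitor_inv_naturality_assoc]

@[simp]
lemma inclR_tensorHom [MonObj A] [MonObj Y] (f : A ⟶ Y) (g : B ⟶ C) [IsMonHom f] :
    inclR A B ≫ (f ⊗ₘ g) = g ≫ inclR Y C := by
  rw [inclR, inclR, Category.assoc, MonoidalCategory.tensorHom_def, ← comp_whiskerRight_assoc,
    IsMonHom.one_hom, ← whisker_exchange, leftUnitor_inv_naturality_assoc]

end Incl

section Smash

variable {B B' Y Y' : M} [BimonObj B] [BimonObj B'] [MonObj Y] [MonObj Y']

/-- The multiplication `mm.1x1` of `Y ⊗ B`, where `x` is the distributive law of an arbitrary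
morphism `l : B ⊗ Y ⟶ Y`. -/
def smash (l : B ⊗ Y ⟶ Y) : (Y ⊗ B) ⊗ (Y ⊗ B) ⟶ Y ⊗ B :=
  (α_ Y B (Y ⊗ B)).hom ≫ Y ◁ ((α_ B Y B).inv ≫ distrib l ▷ B ≫ (α_ Y B B).hom) ≫
    (α_ Y Y (B ⊗ B)).inv ≫ (μ[Y] ⊗ₘ μ[B])

variable {l : B ⊗ Y ⟶ Y} {l' : B' ⊗ Y' ⟶ Y'}

/-- The distributive law is natural. -/
lemma tensorHom_distrib {b : B ⟶ B'} [IsComonHom b] {y : Y ⟶ Y'}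
    (h : (b ⊗ₘ y) ≫ l' = l ≫ y) : (b ⊗ₘ y) ≫ distrib l' = distrib l ≫ (y ⊗ₘ b) := by
  have h₁ : (b ⊗ₘ y) ≫ Δ[B'] ▷ Y' = Δ[B] ▷ Y ≫ ((b ⊗ₘ b) ⊗ₘ y) := by
    rw [← tensorHom_id, ← tensorHom_id, tensorHom_comp_tensorHom, tensorHom_comp_tensorHom,
      IsComonHom.hom_comul, Category.comp_id, Category.id_comp]
  have h₂ : (b ⊗ₘ (b ⊗ₘ y)) ≫ B' ◁ (β_ B' Y').hom = B ◁ (β_ B Y).hom ≫ (b ⊗ₘ (y ⊗ₘ b)) := by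
    rw [← id_tensorHom, ← id_tensorHom, tensorHom_comp_tensorHom, tensorHom_comp_tensorHom,
      BraidedCategory.braiding_naturality, Category.comp_id, Category.id_comp]
  have h₃ : ((b ⊗ₘ y) ⊗ₘ b) ≫ l' ▷ B' = l ▷ B ≫ (y ⊗ₘ b) := by
    rw [← tensorHom_id, ← tensorHom_id, tensorHom_comp_tensorHom, tensorHom_comp_tensorHom,
      h, Category.comp_id, Category.id_comp]
  rw [distrib, distrib, reassoc_of% h₁, associator_naturality_assoc, reassoc_of% h₂,
    associator_inv_naturality_assoc, h₃]
  simp only [Category.assoc]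

/-- The multiplication of the smash product is natural. -/
lemma tensorHom_smash {b : B ⟶ B'} [IsBimonHom b] {y : Y ⟶ Y'} [IsMonHom y]
    (h : (b ⊗ₘ y) ≫ l' = l ≫ y) :
    ((y ⊗ₘ b) ⊗ₘ (y ⊗ₘ b)) ≫ smash l' = smash l ≫ (y ⊗ₘ b) := by
  have h₁ : ((b ⊗ₘ y) ⊗ₘ b) ≫ distrib l' ▷ B' = distrib l ▷ B ≫ ((y ⊗ₘ b) ⊗ₘ b) := by
    rw [← tensorHom_id, ← tensorHom_id, tensorHom_comp_tensorHom, tensorHom_comp_tensorHom,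
      tensorHom_distrib h, Category.comp_id, Category.id_comp]
  have h₂ : (b ⊗ₘ (y ⊗ₘ b)) ≫ (α_ B' Y' B').inv ≫ distrib l' ▷ B' ≫ (α_ Y' B' B').hom =
      ((α_ B Y B).inv ≫ distrib l ▷ B ≫ (α_ Y B B).hom) ≫ (y ⊗ₘ (b ⊗ₘ b)) := by
    rw [associator_inv_naturality_assoc, reassoc_of% h₁, associator_naturality]
    simp only [Category.assoc]
  have h₃ : (y ⊗ₘ (b ⊗ₘ (y ⊗ₘ b))) ≫
      Y' ◁ ((α_ B' Y' B').inv ≫ distrib l' ▷ B' ≫ (α_ Y' B' B').hom) =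
      Y ◁ ((α_ B Y B).inv ≫ distrib l ▷ B ≫ (α_ Y B B).hom) ≫ (y ⊗ₘ (y ⊗ₘ (b ⊗ₘ b))) := by
    rw [← id_tensorHom, ← id_tensorHom, tensorHom_comp_tensorHom, tensorHom_comp_tensorHom, h₂,
      Category.comp_id, Category.id_comp]
  rw [smash, smash, associator_naturality_assoc, reassoc_of% h₃,
    associator_inv_naturality_assoc, tensorHom_comp_tensorHom, ← IsMonHom.mul_hom,
    ← IsMonHom.mul_hom, ← tensorHom_comp_tensorHom]
  simp only [Category.assoc]

end Smash

/-! ### The functor from split epimorphisms to actions -/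

namespace SplitEpiBimon

section Functor

variable [HasEqualizers M]

section Restrict

variable {X X' : SplitEpiBimon M} (f : X ⟶ X')

-- These restate the fields of `Hom` for morphisms `X ⟶ X'`, where instance search does not unfold
-- the category structure.
instance bimon_hom_b : IsBimonHom f.b := f.bimon_b

instance bimon_hom_a : IsBimonHom f.a := f.bimon_a

/-- The restriction of a morphism of split epimorphisms to the cotensor products. -/
def restrict : X.cotensor ⟶ X'.cotensor :=
  X'.lift (X.j ≫ f.a) (by
    have h : f.a ≫ X'.coact = X.coact ≫ (f.a ⊗ₘ f.b) := by
      rw [coact, coact, IsComonHom.hom_comul_assoc, ← id_tensorHom, ← id_tensorHom,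
        tensorHom_comp_tensorHom, Category.assoc, tensorHom_comp_tensorHom, f.comm_s,
        Category.comp_id, Category.id_comp]
    rw [Category.assoc, h, reassoc_of% X.j_coact, inclL_tensorHom, Category.assoc])

@[simp]
lemma restrict_j : restrict f ≫ X'.j = X.j ≫ f.a := X'.lift_j _ _

lemma restrict_tensor_q : (restrict f ⊗ₘ f.b) ≫ X'.q = X.q ≫ f.a := by
  rw [q, q, tensorHom_comp_tensorHom_assoc, restrict_j, f.comm_i, Category.assoc,
    IsMonHom.mul_hom, tensorHom_comp_tensorHom_assoc]

end Restrict

variable [∀ X : M, PreservesLimitsOfShape WalkingParallelPair (tensorLeft X)]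

section Map

variable {X X' : SplitEpiBimon M} [Fact X.CocommAlong] [Fact X'.CocommAlong] [IsIso X.q]
  [IsIso X'.q]

instance (f : X ⟶ X') : IsBimonHom (restrict f) :=
  have : IsBimonHom (restrict f ≫ X'.j) := by rw [restrict_j]; infer_instance
  X'.isBimonHom_of_comp_j (restrict f)

lemma a_proj (f : X ⟶ X') : f.a ≫ X'.proj = X.proj ≫ restrict f := by
  rw [← cancel_epi X.q, ← reassoc_of% (restrict_tensor_q f), q_proj, reassoc_of% @q_proj,
    tensorHom_projL]

/-- The morphism of actions induced by a morphism of split epimorphisms. -/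
def toActMap (f : X ⟶ X') : X.toAct ⟶ X'.toAct :=
  { b := f.b
    y := restrict f
    bimon_b := f.bimon_b
    bimon_y := inferInstanceAs (IsBimonHom (restrict f))
    comm_l := by
      change (f.b ⊗ₘ restrict f) ≫ X'.act = X.act ≫ restrict f
      rw [act, act, Category.assoc, Category.assoc, ← a_proj, IsMonHom.mul_hom_assoc,
        tensorHom_comp_tensorHom_assoc, tensorHom_comp_tensorHom_assoc, restrict_j,
        f.comm_i] : ActBimon.Hom _ _ }

lemma i_inv_q : X.i ≫ inv X.q = inclR X.cotensor X.B := by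
  rw [← inclR_q, Category.assoc, IsIso.hom_inv_id, Category.comp_id]

lemma j_inv_q : X.j ≫ inv X.q = inclL X.cotensor X.B := by
  rw [← inclL_q, Category.assoc, IsIso.hom_inv_id, Category.comp_id]

variable (X) in
/-- `q` identifies the multiplication of the smash product with the one of `A`. -/
lemma smash_act_q : smash X.act ≫ X.q = (X.q ⊗ₘ X.q) ≫ μ[X.A] := by
  have h₁ : (α_ X.cotensor X.cotensor (X.B ⊗ X.B)).inv ≫ (μ[X.cotensor] ⊗ₘ μ[X.B]) ≫ X.q =
      X.cotensor ◁ (α_ X.cotensor X.B X.B).inv ≫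
        (X.j ⊗ₘ (X.q ⊗ₘ X.i) ≫ μ[X.A]) ≫ μ[X.A] := by
    rw [q, tensorHom_comp_tensorHom_assoc, IsMonHom.mul_hom, IsMonHom.mul_hom, tensorHom_mul_assoc,
      Iso.inv_hom_id_assoc, tensorHom_mul_assoc, ← id_tensorHom, tensorHom_comp_tensorHom_assoc,
      Iso.inv_hom_id_assoc, Category.id_comp]
  have h₂ : X.cotensor ◁ (distrib X.act ▷ X.B) ≫ (X.j ⊗ₘ (X.q ⊗ₘ X.i) ≫ μ[X.A]) =
      (X.j ⊗ₘ ((X.i ⊗ₘ X.j) ≫ μ[X.A] ⊗ₘ X.i) ≫ μ[X.A]) := by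
    rw [← id_tensorHom, ← tensorHom_id, tensorHom_comp_tensorHom, tensorHom_comp_tensorHom_assoc,
      distrib_act_q, Category.id_comp, Category.id_comp]
  have h₃ : X.cotensor ◁ (α_ X.B X.cotensor X.B).inv ≫
      (X.j ⊗ₘ ((X.i ⊗ₘ X.j) ≫ μ[X.A] ⊗ₘ X.i) ≫ μ[X.A]) = (X.j ⊗ₘ (X.i ⊗ₘ X.q) ≫ μ[X.A]) := by
    rw [tensorHom_mul_assoc, ← id_tensorHom, tensorHom_comp_tensorHom, Iso.inv_hom_id_assoc,
      Category.id_comp, q]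
  have h₄ : (X.q ⊗ₘ X.q) ≫ μ[X.A] = (α_ _ _ _).hom ≫ (X.j ⊗ₘ (X.i ⊗ₘ X.q) ≫ μ[X.A]) ≫ μ[X.A] := by
    rw [← tensorHom_mul_assoc, ← q]
  rw [h₄, smash]
  simp only [whiskerLeft_comp, Category.assoc]
  rw [h₁, whiskerLeft_hom_inv_assoc, reassoc_of% h₂, reassoc_of% h₃]

lemma smash_act : (inv X.q ⊗ₘ inv X.q) ≫ smash X.act = μ[X.A] ≫ inv X.q := by
  rw [← cancel_mono X.q, Category.assoc, smash_act_q, tensorHom_comp_tensorHom_assoc]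
  simp

/-- The morphism of split epimorphisms corresponding to a morphism of actions. -/
def ofActMap (b : X.B ⟶ X'.B) (y : X.cotensor ⟶ X'.cotensor) [IsBimonHom b] [IsBimonHom y]
    (h : (b ⊗ₘ y) ≫ X'.act = X.act ≫ y) : X ⟶ X' :=
  { b := b
    a := inv X.q ≫ (y ⊗ₘ b) ≫ X'.q
    bimon_a :=
      { one_hom := by
          rw [← IsMonHom.one_hom X.i, Category.assoc, reassoc_of% @i_inv_q,
            reassoc_of% @inclR_tensorHom,
            inclR_q, IsMonHom.one_hom_assoc, IsMonHom.one_hom]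
        mul_hom := by
          rw [← tensorHom_comp_tensorHom, ← tensorHom_comp_tensorHom, Category.assoc,
            Category.assoc, ← smash_act_q, ← reassoc_of% (smash_act (X := X)),
            reassoc_of% (tensorHom_smash h)]
        hom_counit := IsComonHom.hom_counit _
        hom_comul := IsComonHom.hom_comul _ }
    comm_s := by
      rw [Category.assoc, Category.assoc, q_s, tensorHom_projR, reassoc_of% @inv_q_projR]
    comm_i := by
      rw [reassoc_of% @i_inv_q, reassoc_of% @inclR_tensorHom, inclR_q] : Hom X X' }

lemma restrict_ofActMap (b : X.B ⟶ X'.B) (y : X.cotensor ⟶ X'.cotensor) [IsBimonHom b]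
    [IsBimonHom y] (h : (b ⊗ₘ y) ≫ X'.act = X.act ≫ y) : restrict (ofActMap b y h) = y := by
  rw [← cancel_mono X'.j, restrict_j, ofActMap, reassoc_of% @j_inv_q,
    reassoc_of% @inclL_tensorHom, inclL_q]

/-- `toActMap` is surjective because `q` identifies both source and target with smash products. -/
lemma toActMap_surjective (g : X.toAct ⟶ X'.toAct) : ∃ f, toActMap f = g := by
  have : IsBimonHom (show X.B ⟶ X'.B from g.b) := g.bimon_b
  have : IsBimonHom (show X.cotensor ⟶ X'.cotensor from g.y) := g.bimon_y
  exact ⟨ofActMap (show X.B ⟶ X'.B from g.b) (show X.cotensor ⟶ X'.cotensor from g.y) g.comm_l,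
    ActBimon.Hom.ext rfl (restrict_ofActMap _ _ g.comm_l)⟩

/-- `toActMap` is injective because `A` is generated by `A □_B I` and `B` through `q`. -/
lemma toActMap_injective {f f' : X ⟶ X'} (h : toActMap f = toActMap f') : f = f' := by
  have hb : f.b = f'.b := congrArg ActBimon.Hom.b h
  have hy : restrict f = restrict f' := congrArg ActBimon.Hom.y h
  refine Hom.ext hb ?_
  rw [← cancel_epi X.q, ← restrict_tensor_q, ← restrict_tensor_q, hb, hy]

end Map

instance (X : (isRegular M).FullSubcategory) : Fact X.obj.CocommAlong := ⟨X.property.1⟩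

instance (X : (isRegular M).FullSubcategory) : IsIso X.obj.q := X.property.2

variable (M) in
/-- The functor sending a split epimorphism to the action of `B` on `A □_B I`. -/
def toActFunctor : (isRegular M).FullSubcategory ⥤ (ActBimon.cocomm M).FullSubcategory where
  obj X := ⟨X.obj.toAct, X.property.1.isCommComonObj⟩
  map f := ObjectProperty.homMk (toActMap f.hom)
  map_id X := by
    refine ObjectProperty.hom_ext _ (ActBimon.Hom.ext rfl ?_)
    refine (cancel_mono X.obj.j).1 ((restrict_j _).trans ?_)
    exact (Category.comp_id _).trans (Category.id_comp _).symm
  map_comp {X Y Z} f g := by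
    refine ObjectProperty.hom_ext _ (ActBimon.Hom.ext rfl ?_)
    refine (cancel_mono Z.obj.j).1 ((restrict_j _).trans ?_)
    change X.obj.j ≫ f.hom.a ≫ g.hom.a = (restrict f.hom ≫ restrict g.hom) ≫ Z.obj.j
    rw [Category.assoc, restrict_j, reassoc_of% (restrict_j f.hom)]

instance : (toActFunctor M).Faithful where
  map_injective h := ObjectProperty.hom_ext _ (toActMap_injective (congrArg (·.hom) h))

instance : (toActFunctor M).Full where
  map_surjective g := by
    obtain ⟨f, hf⟩ := toActMap_surjective g.hom
    exact ⟨ObjectProperty.homMk f, ObjectProperty.hom_ext _ hf⟩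

end Functor

end SplitEpiBimon

/-! ### The smash product bimonoid -/

lemma tensorHom_whiskerLeft {P P' Q Q' R : M} (f : P ⟶ P') (g : Q ⟶ Q') (h : Q' ⟶ R) :
    (f ⊗ₘ g) ≫ P' ◁ h = P ◁ (g ≫ h) ≫ f ▷ R := by
  rw [whisker_exchange, MonoidalCategory.tensorHom_def]
  simp

namespace ActBimon

section SmashProduct

variable (D : ActBimon M)

/-- The action `y'⊗b⊗y ↦ y' l(b⊗y)` of the smash product `Y ⊗ B` on `Y`. -/
def smashAct : (D.Y ⊗ D.B) ⊗ D.Y ⟶ D.Y := (α_ D.Y D.B D.Y).hom ≫ D.Y ◁ D.l ≫ μ[D.Y]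

lemma inclR_smashAct : inclR D.Y D.B ▷ D.Y ≫ D.smashAct = D.l := by
  rw [smashAct, inclR, comp_whiskerRight, Category.assoc, associator_naturality_left_assoc,
    ← whisker_exchange_assoc, MonObj.one_mul]
  simp

lemma inclL_smashAct : inclL D.Y D.B ▷ D.Y ≫ D.smashAct = μ[D.Y] := by
  rw [smashAct, inclL, comp_whiskerRight, Category.assoc, associator_naturality_middle_assoc,
    ← whiskerLeft_comp_assoc, D.one_act]
  simp

/-- The first component of the multiplication of `Y ⊗ B` only depends on the second factor through
its projection to `Y`; this reduces associativity to `smash_smashAct`. -/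
lemma smash_projL : smash D.l ≫ projL D.Y D.B = (D.Y ⊗ D.B) ◁ projL D.Y D.B ≫ D.smashAct := by
  rw [smash]
  simp only [Category.assoc, tensorHom_projL, reassoc_of% @associator_inv_projL]
  rw [← whiskerLeft_comp_assoc]
  simp only [Category.assoc, whiskerLeft_comp, smashAct, tensor_whiskerLeft,
    Iso.inv_hom_id_assoc, associator_hom_projL, reassoc_of% @whiskerRight_projL, distrib_projL]
  rw [← whiskerLeft_comp_assoc, associator_inv_projL]

lemma smash_projR : smash D.l ≫ projR D.Y D.B = (projR D.Y D.B ⊗ₘ projR D.Y D.B) ≫ μ[D.B] := by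
  have h : (α_ D.B D.Y D.B).inv ≫ projL D.B D.Y ▷ D.B = D.B ◁ projR D.Y D.B := by
    simp [projL, projR]
  rw [smash]
  simp only [Category.assoc, tensorHom_projR, reassoc_of% @associator_inv_projR,
    reassoc_of% @whiskerLeft_projR]
  rw [reassoc_of% @associator_hom_projR, reassoc_of% @associator_hom_projR,
    ← comp_whiskerRight_assoc,
    distrib_projR, reassoc_of% h, MonoidalCategory.tensorHom_def, Category.assoc]

/-- `smashAct` is associative. -/
lemma smash_smashAct :
    smash D.l ▷ D.Y ≫ D.smashAct = (α_ _ _ _).hom ≫ (D.Y ⊗ D.B) ◁ D.smashAct ≫ D.smashAct := by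
  have h₁ := D.act_mul
  rw [diagAct_eq] at h₁
  calc
    smash D.l ▷ D.Y ≫ D.smashAct =
        𝟙 _ ⊗≫ D.Y ◁ distrib D.l ▷ D.B ▷ D.Y ⊗≫ (μ[D.Y] ▷ ((D.B ⊗ D.B) ⊗ D.Y) ≫
          D.Y ◁ (μ[D.B] ▷ D.Y ≫ D.l)) ⊗≫ μ[D.Y] := by
      rw [smash, smashAct, MonoidalCategory.tensorHom_def]
      monoidal
    _ = 𝟙 _ ⊗≫ D.Y ◁ distrib D.l ▷ D.B ▷ D.Y ⊗≫ (D.Y ⊗ D.Y) ◁ D.B ◁ D.l ⊗≫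
          (D.Y ⊗ D.Y) ◁ D.l ⊗≫ μ[D.Y] ▷ D.Y ≫ μ[D.Y] := by
      rw [D.mul_act, ← whisker_exchange]
      monoidal
    _ = 𝟙 _ ⊗≫ D.Y ◁ (distrib D.l ▷ (D.B ⊗ D.Y) ≫ (D.Y ⊗ D.B) ◁ D.l) ⊗≫
          (D.Y ⊗ D.Y) ◁ D.l ⊗≫ D.Y ◁ μ[D.Y] ≫ μ[D.Y] := by
      rw [MonObj.mul_assoc]
      monoidal
    _ = 𝟙 _ ⊗≫ (D.Y ⊗ D.B) ◁ D.Y ◁ D.l ⊗≫ D.Y ◁ (D.B ◁ μ[D.Y] ≫ D.l) ⊗≫ μ[D.Y] := by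
      rw [h₁, ← whisker_exchange]
      monoidal
    _ = _ := by
      rw [smashAct]
      monoidal

/-- The unit of the smash product. -/
def smashOne : 𝟙_ M ⟶ D.Y ⊗ D.B := (λ_ (𝟙_ M)).inv ≫ (η[D.Y] ⊗ₘ η[D.B])

lemma smashOne_eq_inclR : D.smashOne = η[D.B] ≫ inclR D.Y D.B := by
  rw [smashOne, inclR, leftUnitor_inv_naturality_assoc, MonoidalCategory.tensorHom_def']

lemma smashOne_eq_inclL : D.smashOne = η[D.Y] ≫ inclL D.Y D.B := by
  rw [smashOne, inclL, rightUnitor_inv_naturality_assoc, MonoidalCategory.tensorHom_def,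
    unitors_inv_equal]

@[simp]
lemma smashOne_projL : D.smashOne ≫ projL D.Y D.B = η[D.Y] := by
  rw [smashOne_eq_inclL, Category.assoc, inclL_projL, Category.comp_id]

@[simp]
lemma smashOne_projR : D.smashOne ≫ projR D.Y D.B = η[D.B] := by
  rw [smashOne_eq_inclR, Category.assoc, inclR_projR, Category.comp_id]

attribute [local instance] ComonObj.instTensorUnit

instance : IsComonHom D.smashOne := by
  rw [smashOne_eq_inclR]
  infer_instance

variable [IsCommComonObj D.B]

/-- Cocommutativity of `B` makes the multiplication of the smash product a comonoid morphism. -/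
instance isComonHom_smash : IsComonHom (smash D.l) :=
  inferInstanceAs (IsComonHom ((α_ D.Y D.B (D.Y ⊗ D.B)).hom ≫
    D.Y ◁ ((α_ D.B D.Y D.B).inv ≫ distrib D.l ▷ D.B ≫ (α_ D.Y D.B D.B).hom) ≫
      (α_ D.Y D.Y (D.B ⊗ D.B)).inv ≫ (μ[D.Y] ⊗ₘ μ[D.B])))

lemma smashOne_smash : D.smashOne ▷ (D.Y ⊗ D.B) ≫ smash D.l = (λ_ _).hom := by
  refine comonHom_ext ?_ ?_
  · rw [Category.assoc, smash_projL, ← whisker_exchange_assoc, smashOne_eq_inclL,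
      comp_whiskerRight_assoc, inclL_smashAct, MonObj.one_mul, leftUnitor_naturality]
  · rw [Category.assoc, smash_projR, ← tensorHom_id, tensorHom_comp_tensorHom_assoc,
      smashOne_projR, Category.id_comp, MonObj.one_mul_hom]

lemma smash_smashOne : (D.Y ⊗ D.B) ◁ D.smashOne ≫ smash D.l = (ρ_ _).hom := by
  refine comonHom_ext ?_ ?_
  · rw [Category.assoc, smash_projL, ← whiskerLeft_comp_assoc, smashOne_projL, smashAct,
      associator_naturality_right_assoc, ← whiskerLeft_comp_assoc, D.act_one, trivAct,
      whiskerLeft_comp_assoc, MonObj.mul_one]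
    rw [unitors_equal, rightUnitor_naturality, projL, rightUnitor_tensor_hom,
      whiskerLeft_comp_assoc, Category.assoc]
  · rw [Category.assoc, smash_projR, ← id_tensorHom, tensorHom_comp_tensorHom_assoc,
      smashOne_projR, Category.id_comp, MonObj.mul_one_hom]

lemma smash_assoc :
    smash D.l ▷ (D.Y ⊗ D.B) ≫ smash D.l = (α_ _ _ _).hom ≫ (D.Y ⊗ D.B) ◁ smash D.l ≫ smash D.l := by
  refine comonHom_ext ?_ ?_
  · rw [Category.assoc, Category.assoc, Category.assoc, smash_projL, ← whisker_exchange_assoc,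
      smash_smashAct, ← whiskerLeft_comp_assoc, smash_projL]
    simp
  · rw [Category.assoc, Category.assoc, Category.assoc, smash_projR, ← tensorHom_id,
      ← id_tensorHom, tensorHom_comp_tensorHom_assoc, tensorHom_comp_tensorHom_assoc, smash_projR,
      Category.id_comp, tensorHom_mul_assoc]

lemma inclR_tensor_inclR_smash :
    (inclR D.Y D.B ⊗ₘ inclR D.Y D.B) ≫ smash D.l = μ[D.B] ≫ inclR D.Y D.B := by
  refine comonHom_ext ?_ ?_
  · rw [Category.assoc, Category.assoc, smash_projL, inclR_projL, IsComonHom.hom_counit_assoc,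
      reassoc_of% @tensorHom_whiskerLeft, inclR_smashAct, inclR_projL, whiskerLeft_comp_assoc,
      D.act_one,
      reassoc_of% whiskerLeft_counit_trivAct]
  · rw [Category.assoc, Category.assoc, smash_projR, tensorHom_comp_tensorHom_assoc, inclR_projR,
      Category.comp_id, id_tensorHom_id, Category.id_comp]

lemma inclL_tensor_inclL_smash :
    (inclL D.Y D.B ⊗ₘ inclL D.Y D.B) ≫ smash D.l = μ[D.Y] ≫ inclL D.Y D.B := by
  refine comonHom_ext ?_ ?_
  · rw [Category.assoc, Category.assoc, smash_projL, inclL_projL,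
      reassoc_of% @tensorHom_whiskerLeft, inclL_smashAct, inclL_projL, Category.comp_id,
      whiskerLeft_id,
      Category.id_comp]
  · rw [Category.assoc, Category.assoc, smash_projR, tensorHom_comp_tensorHom_assoc, inclL_projR,
      IsComonHom.hom_counit_assoc, ← tensorHom_comp_tensorHom, Category.assoc,
      Comon.tensorObj_counit, Category.assoc, MonObj.mul_one_hom, unitors_equal]

/-- The smash product is generated by `Y` and `B`. -/
lemma inclL_tensor_inclR_smash :
    (inclL D.Y D.B ⊗ₘ inclR D.Y D.B) ≫ smash D.l = 𝟙 _ := by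
  refine comonHom_ext ?_ ?_
  · rw [Category.assoc, Category.id_comp, smash_projL,
      reassoc_of% @tensorHom_whiskerLeft, inclL_smashAct, inclR_projL, whiskerLeft_comp_assoc,
      MonObj.mul_one, projL]
  · rw [Category.assoc, Category.id_comp, smash_projR, tensorHom_comp_tensorHom_assoc, inclL_projR,
      inclR_projR, ← Category.id_comp (𝟙 D.B), ← tensorHom_comp_tensorHom, Category.assoc,
      MonObj.one_mul_hom, Category.comp_id, tensorHom_id, projR]

/-- The action is recovered from the multiplication of the smash product. -/
lemma inclR_tensor_inclL_smash_projL :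
    (inclR D.Y D.B ⊗ₘ inclL D.Y D.B) ≫ smash D.l ≫ projL D.Y D.B = D.l := by
  rw [smash_projL, reassoc_of% @tensorHom_whiskerLeft, inclR_smashAct, inclL_projL,
    whiskerLeft_id, Category.id_comp]

/-- The smash product of `Y` and `B`, as a monoid. -/
@[reducible] def smashMon : MonObj (D.Y ⊗ D.B) where
  one := D.smashOne
  mul := smash D.l
  one_mul := D.smashOne_smash
  mul_one := D.smash_smashOne
  mul_assoc := D.smash_assoc

/-- The smash product of `Y` and `B`, with the tensor product comonoid structure. -/
@[reducible] def smashBimon : BimonObj (D.Y ⊗ D.B) :=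
  { D.smashMon, (inferInstance : ComonObj (D.Y ⊗ D.B)) with
    mul_comul := by
      refine (IsComonHom.hom_comul (smash D.l)).trans ?_
      rw [Comon.tensorObj_comul (D.Y ⊗ D.B), Category.assoc]
      rfl
    one_comul := IsComonHom.hom_comul D.smashOne
    mul_counit := IsComonHom.hom_counit (smash D.l)
    one_counit := IsComonHom.hom_counit D.smashOne }

/-- The split epimorphism `B ⟶ Y ⊗ B ⟶ B` associated with an action. -/
def toSplitEpi : SplitEpiBimon M :=
  let _ : BimonObj (D.Y ⊗ D.B) := D.smashBimon
  { A := D.Y ⊗ D.B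
    B := D.B
    i := inclR D.Y D.B
    s := projR D.Y D.B
    bimon_i :=
      { one_hom := D.smashOne_eq_inclR.symm
        mul_hom := D.inclR_tensor_inclR_smash.symm
        hom_counit := IsComonHom.hom_counit (inclR D.Y D.B)
        hom_comul := IsComonHom.hom_comul (inclR D.Y D.B) }
    bimon_s :=
      { one_hom := D.smashOne_projR
        mul_hom := D.smash_projR
        hom_counit := IsComonHom.hom_counit (projR D.Y D.B)
        hom_comul := IsComonHom.hom_comul (projR D.Y D.B) }
    i_s := inclR_projR }

/-- `toSplitEpi` is the split epimorphism of the smash product. -/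
def smashIsoToSplitEpi : SmashIso D D.toSplitEpi where
  isoB := Iso.refl D.B
  isoA := Iso.refl (D.Y ⊗ D.B)
  bimon_isoB := isBimonHom_id D.B
  comon_isoA := (inferInstance : IsComonHom (𝟙 (D.Y ⊗ D.B)))
  one_isoA := Category.comp_id D.smashOne
  mul_isoA := by
    change smash D.l ≫ 𝟙 _ = (𝟙 (D.Y ⊗ D.B) ⊗ₘ 𝟙 (D.Y ⊗ D.B)) ≫ smash D.l
    simp
  comm_i := by
    change inclR D.Y D.B ≫ 𝟙 _ = 𝟙 _ ≫ inclR D.Y D.B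
    simp
  comm_s := by
    change projR D.Y D.B ≫ 𝟙 _ = 𝟙 _ ≫ projR D.Y D.B
    simp

end SmashProduct

end ActBimon

/-! ### Split epimorphisms isomorphic to a smash product -/

lemma comul_whiskerLeft_projR (Y B : M) [ComonObj Y] [ComonObj B] :
    Δ[Y ⊗ B] ≫ (Y ⊗ B) ◁ projR Y B = Y ◁ Δ[B] ≫ (α_ Y B B).inv := by
  have h := tensorμ_natural (𝟙 Y) ε[Y] (𝟙 B) (𝟙 B)
  rw [projR, Comon.tensorObj_comul, whiskerLeft_comp, ← tensorHom_id, ← id_tensorHom,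
    ← id_tensorHom_id, Category.assoc, ← reassoc_of% h, tensorHom_comp_tensorHom_assoc,
    ComonObj.comul_counit_hom, id_tensorHom_id, Category.comp_id, Category.id_comp, tensorμ,
    braiding_tensorUnit_left]
  simp only [MonoidalCategory.tensorHom_def', comp_whiskerRight, whiskerLeft_comp, Category.assoc]
  monoidal

lemma comul_whiskerRight_projR_braiding (Y B : M) [ComonObj Y] [ComonObj B] [IsCommComonObj B] :
    Δ[Y ⊗ B] ≫ projR Y B ▷ (Y ⊗ B) ≫ (β_ B (Y ⊗ B)).hom =
      Δ[Y ⊗ B] ≫ (Y ⊗ B) ◁ projR Y B := by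
  have h := tensorμ_natural ε[Y] (𝟙 Y) (𝟙 B) (𝟙 B)
  rw [comul_whiskerLeft_projR, projR, Comon.tensorObj_comul, comp_whiskerRight_assoc,
    ← tensorHom_id, ← tensorHom_id, ← id_tensorHom_id, Category.assoc, ← reassoc_of% h,
    tensorHom_comp_tensorHom_assoc,
    ComonObj.counit_comul_hom, id_tensorHom_id, Category.comp_id, Category.id_comp, tensorμ,
    BraidedCategory.braiding_tensor_right_hom]
  simp [MonoidalCategory.tensorHom_def']
  rw [← comp_whiskerRight_assoc, SymmetricCategory.symmetry, id_whiskerRight, Category.id_comp,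
    Iso.inv_hom_id_assoc, ← whiskerLeft_comp_assoc, IsCommComonObj.comul_comm]

namespace SmashIso

variable {D : ActBimon M} {X : SplitEpiBimon M} (σ : SmashIso D X)

include σ

instance : IsComonHom σ.isoA.hom := σ.comon_isoA

instance : IsBimonHom σ.isoB.hom := σ.bimon_isoB

-- The fields of `SmashIso`, restated through `inclR`, `projR`, `smash` and `smashOne`.
lemma comm_i' : X.i ≫ σ.isoA.hom = σ.isoB.hom ≫ inclR D.Y D.B := σ.comm_i

lemma comm_s' : X.s ≫ σ.isoB.hom = σ.isoA.hom ≫ projR D.Y D.B := σ.comm_s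

lemma mul_isoA' : μ[X.A] ≫ σ.isoA.hom = (σ.isoA.hom ⊗ₘ σ.isoA.hom) ≫ smash D.l := σ.mul_isoA

lemma one_isoA' : η[X.A] ≫ σ.isoA.hom = D.smashOne := σ.one_isoA

lemma coact_isoA : X.coact ≫ (σ.isoA.hom ⊗ₘ σ.isoB.hom) =
    σ.isoA.hom ≫ Δ[D.Y ⊗ D.B] ≫ (D.Y ⊗ D.B) ◁ projR D.Y D.B := by
  rw [SplitEpiBimon.coact, Category.assoc, ← id_tensorHom, tensorHom_comp_tensorHom, σ.comm_s',
    IsComonHom.hom_comul_assoc, ← id_tensorHom, tensorHom_comp_tensorHom, Category.id_comp,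
    Category.comp_id]

/-- Cocommutativity of `B` gives the condition `c.s1.δ = 1s.δ` for the smash product, as it only
involves the comultiplication of `B`. -/
lemma cocommAlong [IsCommComonObj D.B] : X.CocommAlong := by
  change _ = X.coact
  rw [← cancel_mono (σ.isoA.hom ⊗ₘ σ.isoB.hom), coact_isoA, ← comul_whiskerRight_projR_braiding,
    Category.assoc, Category.assoc, ← BraidedCategory.braiding_naturality, ← tensorHom_id,
    tensorHom_comp_tensorHom_assoc, σ.comm_s', IsComonHom.hom_comul_assoc, ← tensorHom_id,
    tensorHom_comp_tensorHom_assoc, Category.id_comp, Category.comp_id]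

variable [HasEqualizers M]

/-- The comparison of `Y` with the cotensor product. -/
def toCotensor : D.Y ⟶ X.cotensor :=
  X.lift (inclL D.Y D.B ≫ σ.isoA.inv) (by
    have h : inclL D.Y D.B ≫ Δ[D.Y ⊗ D.B] ≫ (D.Y ⊗ D.B) ◁ projR D.Y D.B =
        inclL D.Y D.B ≫ inclL (D.Y ⊗ D.B) D.B := by
      rw [IsComonHom.hom_comul_assoc, ← id_tensorHom, tensorHom_comp_tensorHom, inclL_projR,
        Category.comp_id, ← Category.id_comp (inclL D.Y D.B), ← tensorHom_comp_tensorHom,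
        ComonObj.comul_counit_hom_assoc, Category.id_comp, inclL, inclL,
        MonoidalCategory.tensorHom_def]
      simp
    rw [← cancel_mono (σ.isoA.hom ⊗ₘ σ.isoB.hom)]
    simp only [Category.assoc]
    rw [coact_isoA, Iso.inv_hom_id_assoc, h, inclL_tensorHom, Iso.inv_hom_id_assoc])

@[simp]
lemma toCotensor_j : σ.toCotensor ≫ X.j = inclL D.Y D.B ≫ σ.isoA.inv := X.lift_j _ _

/-- `Y` is identified with the cotensor product. -/
def isoCotensor : D.Y ≅ X.cotensor where
  hom := σ.toCotensor
  inv := X.j ≫ σ.isoA.hom ≫ projL D.Y D.B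
  hom_inv_id := by
    rw [reassoc_of% @toCotensor_j, Iso.inv_hom_id_assoc, inclL_projL]
  inv_hom_id := by
    have h := X.j_coact =≫ ((σ.isoA.hom ⊗ₘ σ.isoB.hom) ≫ projL D.Y D.B ▷ D.B)
    rw [Category.assoc, reassoc_of% σ.coact_isoA, ← MonoidalCategory.tensorHom_def',
      comul_projL_projR, Category.comp_id, Category.assoc, reassoc_of% @inclL_tensorHom,
      ← tensorHom_id,
      inclL_tensorHom] at h
    rw [← cancel_mono X.j]
    simp only [Category.assoc, toCotensor_j]
    rw [← reassoc_of% h]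
    simp

instance : IsIso σ.toCotensor := σ.isoCotensor.isIso_hom

variable [IsCommComonObj D.B]

/-- Up to the comparison of `Y` with the cotensor product, `q` is the inverse of the identification
of `A` with `Y ⊗ B`. -/
lemma toCotensor_tensor_q :
    (σ.toCotensor ⊗ₘ σ.isoB.inv) ≫ X.q = σ.isoA.inv := by
  have h : σ.isoB.inv ≫ X.i ≫ σ.isoA.hom = inclR D.Y D.B := by
    rw [σ.comm_i', Iso.inv_hom_id_assoc]
  have h : (σ.isoB.inv ≫ X.i) ≫ σ.isoA.hom = inclR D.Y D.B := by rw [Category.assoc, h]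
  rw [← cancel_mono σ.isoA.hom, Iso.inv_hom_id, SplitEpiBimon.q, Category.assoc, Category.assoc,
    mul_isoA', tensorHom_comp_tensorHom_assoc, tensorHom_comp_tensorHom_assoc, Category.assoc,
    reassoc_of% @toCotensor_j, Iso.inv_hom_id, h, Category.comp_id, D.inclL_tensor_inclR_smash]

lemma isIso_q : IsIso X.q := by
  have h := σ.toCotensor_tensor_q
  have : IsIso ((σ.toCotensor ⊗ₘ σ.isoB.inv) ≫ X.q) := by rw [h]; infer_instance
  exact IsIso.of_isIso_comp_left (σ.toCotensor ⊗ₘ σ.isoB.inv) X.q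

lemma inclL_isoA_inv_isMonHom : IsMonHom (inclL D.Y D.B ≫ σ.isoA.inv) where
  one_hom := by
    rw [← cancel_mono σ.isoA.hom, Category.assoc, Category.assoc, Iso.inv_hom_id, Category.comp_id,
      one_isoA', D.smashOne_eq_inclL]
  mul_hom := by
    rw [← cancel_mono σ.isoA.hom, Category.assoc, Category.assoc, Iso.inv_hom_id, Category.comp_id,
      Category.assoc, mul_isoA', tensorHom_comp_tensorHom_assoc, Category.assoc, Iso.inv_hom_id,
      Category.comp_id, D.inclL_tensor_inclL_smash]

variable [∀ X : M, PreservesLimitsOfShape WalkingParallelPair (tensorLeft X)]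
  [Fact X.CocommAlong]

instance isBimonHom_toCotensor : IsBimonHom σ.toCotensor :=
  have h₁ : IsMonHom (σ.toCotensor ≫ X.j) := by
    rw [toCotensor_j]; exact σ.inclL_isoA_inv_isMonHom
  have h₂ : IsComonHom (σ.toCotensor ≫ X.j) := by
    rw [toCotensor_j]; infer_instance
  have : IsBimonHom (σ.toCotensor ≫ X.j) := { h₁, h₂ with }
  X.isBimonHom_of_comp_j σ.toCotensor

variable [IsIso X.q]

lemma toCotensor_act : (σ.isoB.inv ⊗ₘ σ.toCotensor) ≫ X.act = D.l ≫ σ.toCotensor := by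
  have hp : σ.isoA.inv ≫ X.proj = projL D.Y D.B ≫ σ.toCotensor := by
    rw [← toCotensor_tensor_q, Category.assoc, X.q_proj, tensorHom_projL]
  have hi : σ.isoB.inv ≫ X.i = inclR D.Y D.B ≫ σ.isoA.inv := by
    rw [Iso.inv_comp_eq, ← Category.assoc, Iso.eq_comp_inv, σ.comm_i']
  have hm : (σ.isoA.inv ⊗ₘ σ.isoA.inv) ≫ μ[X.A] = smash D.l ≫ σ.isoA.inv := by
    rw [Iso.eq_comp_inv, Category.assoc, mul_isoA', tensorHom_comp_tensorHom_assoc]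
    simp
  rw [SplitEpiBimon.act, tensorHom_comp_tensorHom_assoc, hi, toCotensor_j,
    ← tensorHom_comp_tensorHom, Category.assoc, reassoc_of% hm, hp,
    reassoc_of% D.inclR_tensor_inclL_smash_projL]

end SmashIso

instance isBimonHom_iso_inv {A B : M} [BimonObj A] [BimonObj B] (e : A ≅ B) [IsBimonHom e.hom] :
    IsBimonHom e.inv where

/-- An isomorphism of actions from compatible isomorphisms of bimonoids. -/
def ActBimon.mkIso {D D' : ActBimon M} (b : D.B ≅ D'.B) (y : D.Y ≅ D'.Y) (hb : IsBimonHom b.hom)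
    (hy : IsBimonHom y.hom) (h : (b.hom ⊗ₘ y.hom) ≫ D'.l = D.l ≫ y.hom) : D ≅ D' where
  hom := ({ b := b.hom, y := y.hom, comm_l := h } : ActBimon.Hom D D')
  inv := ({ b := b.inv
            y := y.inv
            comm_l := by
              rw [← cancel_mono y.hom, Category.assoc, Category.assoc, ← h,
                tensorHom_comp_tensorHom_assoc]
              simp } : ActBimon.Hom D' D)
  hom_inv_id := ActBimon.Hom.ext b.hom_inv_id y.hom_inv_id
  inv_hom_id := ActBimon.Hom.ext b.inv_hom_id y.inv_hom_id

section Equivalence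

variable [HasEqualizers M] [∀ X : M, PreservesLimitsOfShape WalkingParallelPair (tensorLeft X)]

open SplitEpiBimon

instance : (toActFunctor M).EssSurj where
  mem_essImage D := by
    have : IsCommComonObj D.obj.B := D.property
    let σ := D.obj.smashIsoToSplitEpi
    have h₁ := σ.cocommAlong
    have h₂ := σ.isIso_q
    let X : (isRegular M).FullSubcategory := ⟨D.obj.toSplitEpi, h₁, h₂⟩
    have : Fact D.obj.toSplitEpi.CocommAlong := ⟨h₁⟩
    exact ⟨X, ⟨(ObjectProperty.isoMk _ (ActBimon.mkIso (D' := X.obj.toAct) σ.isoB.symm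
      σ.isoCotensor (isBimonHom_iso_inv σ.isoB) σ.isBimonHom_toCotensor σ.toCotensor_act)).symm⟩⟩

end Equivalence

/-! ### Antipodes and cocommutativity -/

section Transport

lemma isHopf_of_iso {A B : M} [BimonObj A] [BimonObj B] (e : A ≅ B) (he : IsBimonHom e.hom)
    (h : IsHopf A) : IsHopf B := by
  obtain ⟨z, hz⟩ := h
  refine isHopf_of_conv (z := e.inv ≫ z ≫ e.hom) ?_ ?_
  · rw [← e.inv_hom_id, hz.conv_left]
  · rw [← e.inv_hom_id, hz.conv_right]

lemma isCommComonObj_of_iso {A B : M} [ComonObj A] [ComonObj B] (e : A ≅ B)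
    (he : IsComonHom e.hom) [IsCommComonObj A] : IsCommComonObj B where
  comul_comm := by
    rw [← cancel_epi e.hom, IsComonHom.hom_comul_assoc, IsComonHom.hom_comul,
      BraidedCategory.braiding_naturality, IsCommComonObj.comul_comm_assoc]

lemma isCommComonObj_of_mono {A B : M} [ComonObj A] [ComonObj B] (f : A ⟶ B) [IsComonHom f]
    [Mono (f ⊗ₘ f)] [IsCommComonObj B] : IsCommComonObj A where
  comul_comm := by
    rw [← cancel_mono (f ⊗ₘ f), Category.assoc, ← BraidedCategory.braiding_naturality,
      ← IsComonHom.hom_comul_assoc, IsCommComonObj.comul_comm, IsComonHom.hom_comul]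

end Transport

namespace SplitEpiBimon

lemma cocommAlong_of_isCommComonObj (X : SplitEpiBimon M) [IsCommComonObj X.A] :
    X.CocommAlong := by
  rw [CocommAlong, BraidedCategory.braiding_naturality_left, IsCommComonObj.comul_comm_assoc]

variable [HasEqualizers M] [∀ X : M, PreservesLimitsOfShape WalkingParallelPair (tensorLeft X)]

section

variable (X : SplitEpiBimon M) [Fact X.CocommAlong]

/-- The antipode `z` of `A` restricts to the cotensor product: composing from right to left, both
`1s.δ.z.j` and `1u.z.j` are convolution inverse to `1s.δ.j = 1u.j`. -/
lemma isHopf_cotensor (h : IsHopf X.A) : IsHopf X.cotensor := by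
  obtain ⟨z, hz⟩ := h
  have h : (X.j ≫ z) ≫ X.coact = (X.j ≫ z) ≫ inclL X.A X.B := by
    rw [Category.assoc, Category.assoc]
    refine eq_of_conv_eq_unit (hz.conv_left X.j X.coact) ?_
    rw [j_coact, hz.conv_right]
  have hl := hz.conv_left X.j (𝟙 X.A)
  have hr := hz.conv_right X.j (𝟙 X.A)
  rw [Category.comp_id, Category.comp_id] at hl hr
  have hone : ε[X.cotensor] ≫ η[X.A] = (ε[X.cotensor] ≫ η[X.cotensor]) ≫ X.j := by
    rw [Category.assoc, IsMonHom.one_hom]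
  refine isHopf_of_conv (z := X.lift (X.j ≫ z) h) ?_ ?_
  · rw [← cancel_mono X.j, conv_comp, lift_j, Category.id_comp, hl, hone]
  · rw [← cancel_mono X.j, conv_comp, lift_j, Category.id_comp, hr, hone]

/-- The identity of `A ≅ (A □_B I) ⊗ B` is the convolution product of the projections to
`A □_B I` and `B`, so the product of their inverses in the opposite order is an antipode. -/
lemma isHopf_A [IsIso X.q] (hY : IsHopf X.cotensor) (hB : IsHopf X.B) : IsHopf X.A := by
  obtain ⟨y, hy⟩ := hY
  obtain ⟨z, hz⟩ := hB
  have h : 𝟙 X.A = (X.proj ≫ X.j) ⋆ (X.s ≫ X.i) := by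
    rw [← comul_lift_q, ← Category.assoc, ← inv_q, IsIso.inv_hom_id]
  refine isHopf_of_conv (z := (X.s ≫ z ≫ X.i) ⋆ (X.proj ≫ y ≫ X.j)) ?_ ?_
  · rw [h, conv_assoc, ← conv_assoc (X.proj ≫ y ≫ X.j), hy.conv_left, unit_conv, hz.conv_left]
  · rw [h, conv_assoc, ← conv_assoc (X.s ≫ X.i), hz.conv_right, unit_conv, hy.conv_right]

end

/-! ### The equivalences -/

lemma hopfCodomain_le_isRegular : hopfCodomain M ≤ isRegular M := by
  rintro X ⟨hX, z, hz⟩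
  have : Fact X.CocommAlong := ⟨hX⟩
  exact ⟨hX, isIso_q hz⟩

lemma cocommHopf_le_hopfCodomain : cocommHopf M ≤ hopfCodomain M := by
  rintro X ⟨⟨hA, -⟩, -, hB⟩
  exact ⟨X.cocommAlong_of_isCommComonObj, hB⟩

variable (M) in
/-- The restriction of `toActFunctor` to split epimorphisms with Hopf codomain. -/
def toActFunctorHopf :
    (hopfCodomain M).FullSubcategory ⥤ (ActBimon.cocommHopfActing M).FullSubcategory :=
  ObjectProperty.lift _ (ObjectProperty.ιOfLE hopfCodomain_le_isRegular ⋙ toActFunctor M ⋙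
    ObjectProperty.ι _) fun X => ⟨X.property.1.isCommComonObj, X.property.2⟩

variable (M) in
/-- The restriction of `toActFunctor` to split epimorphisms of cocommutative Hopf monoids. -/
def toActFunctorCocommHopf :
    (cocommHopf M).FullSubcategory ⥤ (ActBimon.cocommHopf M).FullSubcategory :=
  ObjectProperty.lift _ (ObjectProperty.ιOfLE (cocommHopf_le_hopfCodomain.trans
    hopfCodomain_le_isRegular) ⋙ toActFunctor M ⋙ ObjectProperty.ι _) fun X => by
      have : Fact X.obj.CocommAlong := ⟨(cocommHopf_le_hopfCodomain _ X.property).1⟩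
      have : IsCommComonObj X.obj.A := X.property.1.1
      have hY : IsCommComonObj X.obj.cotensor := isCommComonObj_of_mono X.obj.j
      exact ⟨X.property.2, hY, X.obj.isHopf_cotensor X.property.1.2⟩

instance : (toActFunctorHopf M).Faithful :=
  Functor.Faithful.of_comp_iso
    (F := toActFunctorHopf M) (G := ObjectProperty.ι _)
    (H := ObjectProperty.ιOfLE hopfCodomain_le_isRegular ⋙ toActFunctor M ⋙ ObjectProperty.ι _)
    (Iso.refl _)

instance : (toActFunctorHopf M).Full :=
  Functor.Full.of_comp_faithful_iso
    (F := toActFunctorHopf M) (G := ObjectProperty.ι _)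
    (H := ObjectProperty.ιOfLE hopfCodomain_le_isRegular ⋙ toActFunctor M ⋙ ObjectProperty.ι _)
    (Iso.refl _)

instance : (toActFunctorCocommHopf M).Faithful :=
  Functor.Faithful.of_comp_iso
    (F := toActFunctorCocommHopf M) (G := ObjectProperty.ι _)
    (H := ObjectProperty.ιOfLE (cocommHopf_le_hopfCodomain.trans hopfCodomain_le_isRegular) ⋙
      toActFunctor M ⋙ ObjectProperty.ι _)
    (Iso.refl _)

instance : (toActFunctorCocommHopf M).Full :=
  Functor.Full.of_comp_faithful_iso
    (F := toActFunctorCocommHopf M) (G := ObjectProperty.ι _)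
    (H := ObjectProperty.ιOfLE (cocommHopf_le_hopfCodomain.trans hopfCodomain_le_isRegular) ⋙
      toActFunctor M ⋙ ObjectProperty.ι _)
    (Iso.refl _)

end SplitEpiBimon

namespace ActBimon

lemma cocommHopfActing_le_cocomm : cocommHopfActing M ≤ cocomm M := fun _ h => h.1

lemma cocommHopf_le_cocommHopfActing : cocommHopf M ≤ cocommHopfActing M := fun _ h => h.1

variable {D D' : ActBimon M}

/-- The isomorphism of acting bimonoids underlying an isomorphism of actions. -/
def isoB (e : D ≅ D') : D.B ≅ D'.B where
  hom := e.hom.b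
  inv := e.inv.b
  hom_inv_id := congrArg Hom.b e.hom_inv_id
  inv_hom_id := congrArg Hom.b e.inv_hom_id

/-- The isomorphism of bimonoids acted on underlying an isomorphism of actions. -/
def isoY (e : D ≅ D') : D.Y ≅ D'.Y where
  hom := e.hom.y
  inv := e.inv.y
  hom_inv_id := congrArg Hom.y e.hom_inv_id
  inv_hom_id := congrArg Hom.y e.inv_hom_id

instance (e : D ≅ D') : IsBimonHom (isoB e).hom := e.hom.bimon_b

instance (e : D ≅ D') : IsBimonHom (isoY e).hom := e.hom.bimon_y

end ActBimon

section Equivalence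

variable [HasEqualizers M] [∀ X : M, PreservesLimitsOfShape WalkingParallelPair (tensorLeft X)]

open SplitEpiBimon

lemma exists_toAct_iso (D : ActBimon M) (hD : IsCommComonObj D.B) :
    ∃ X : (isRegular M).FullSubcategory, Nonempty (X.obj.toAct ≅ D) := by
  obtain ⟨X, ⟨e⟩⟩ := Functor.EssSurj.mem_essImage (F := toActFunctor M) ⟨D, hD⟩
  exact ⟨X, ⟨(ObjectProperty.ι _).mapIso e⟩⟩

instance : (toActFunctorHopf M).EssSurj where
  mem_essImage D := by
    obtain ⟨X, ⟨e⟩⟩ := exists_toAct_iso D.obj D.property.1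
    exact ⟨⟨X.obj, X.property.1,
      isHopf_of_iso (ActBimon.isoB e.symm) e.inv.bimon_b D.property.2⟩,
      ⟨ObjectProperty.isoMk _ e⟩⟩

instance : (toActFunctorCocommHopf M).EssSurj where
  mem_essImage D := by
    obtain ⟨X, ⟨e⟩⟩ := exists_toAct_iso D.obj D.property.1.1
    have hDB : IsCommComonObj D.obj.B := D.property.1.1
    have hDY : IsCommComonObj D.obj.Y := D.property.2.1
    have hB : IsHopf X.obj.B :=
      isHopf_of_iso (ActBimon.isoB e.symm) e.inv.bimon_b D.property.1.2
    have hY : IsHopf X.obj.cotensor :=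
      isHopf_of_iso (ActBimon.isoY e.symm) e.inv.bimon_y D.property.2.2
    have : IsCommComonObj X.obj.B :=
      isCommComonObj_of_iso (ActBimon.isoB e.symm) e.inv.bimon_b.toIsComonHom
    have : IsCommComonObj X.obj.cotensor :=
      isCommComonObj_of_iso (ActBimon.isoY e.symm) e.inv.bimon_y.toIsComonHom
    exact ⟨⟨X.obj, ⟨isCommComonObj_of_iso (asIso X.obj.q) X.obj.isComonHom_q,
          X.obj.isHopf_A hY hB⟩, inferInstance, hB⟩,
      ⟨ObjectProperty.isoMk _ e⟩⟩

instance : (toActFunctor M).IsEquivalence where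

instance : (toActFunctorHopf M).IsEquivalence where

instance : (toActFunctorCocommHopf M).IsEquivalence where

/-- The action associated with a split epimorphism is given by the cotensor product. -/
def cotensorIsoToAct (X : SplitEpiBimon M) [Fact X.CocommAlong] [IsIso X.q] :
    CotensorIso X X.toAct where
  isoB := Iso.refl _
  isoY := Iso.refl _
  bimon_isoB := isBimonHom_id X.B
  bimon_isoY := by
    change IsBimonHom (𝟙 X.cotensor ≫ X.j)
    infer_instance
  act := by
    change distrib X.act ≫ (𝟙 X.cotensor ⊗ₘ 𝟙 X.B) ≫ X.q =
      (𝟙 X.B ⊗ₘ 𝟙 X.cotensor) ≫ (X.i ⊗ₘ X.j) ≫ μ[X.A]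
    rw [id_tensorHom_id, id_tensorHom_id, Category.id_comp, Category.id_comp, distrib_act_q]

/-- A split epimorphism whose action is isomorphic to `D` is the smash product of `D`. -/
def smashIsoOfIso (X : SplitEpiBimon M) [Fact X.CocommAlong] [IsIso X.q] {D : ActBimon M}
    (b : X.B ≅ D.B) (y : X.cotensor ≅ D.Y) [IsBimonHom b.hom] [IsBimonHom y.hom]
    (h : (b.hom ⊗ₘ y.hom) ≫ D.l = X.act ≫ y.hom) : SmashIso D X where
  isoB := b
  isoA := (asIso X.q).symm ≪≫ (y ⊗ᵢ b)
  bimon_isoB := inferInstance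
  comon_isoA := inferInstanceAs (IsComonHom (inv X.q ≫ (y.hom ⊗ₘ b.hom)))
  one_isoA := by
    change η[X.A] ≫ inv X.q ≫ (y.hom ⊗ₘ b.hom) = D.smashOne
    rw [← IsMonHom.one_hom X.i, Category.assoc, reassoc_of% @i_inv_q, inclR_tensorHom,
      IsMonHom.one_hom_assoc, D.smashOne_eq_inclR]
  mul_isoA := by
    change μ[X.A] ≫ inv X.q ≫ (y.hom ⊗ₘ b.hom) =
      (inv X.q ≫ (y.hom ⊗ₘ b.hom) ⊗ₘ inv X.q ≫ (y.hom ⊗ₘ b.hom)) ≫ smash D.l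
    rw [← reassoc_of% (smash_act (X := X)), ← tensorHom_comp_tensorHom, Category.assoc,
      tensorHom_smash h]
  comm_i := by
    change X.i ≫ inv X.q ≫ (y.hom ⊗ₘ b.hom) = b.hom ≫ inclR D.Y D.B
    rw [reassoc_of% @i_inv_q, inclR_tensorHom]
  comm_s := by
    change X.s ≫ b.hom = (inv X.q ≫ (y.hom ⊗ₘ b.hom)) ≫ projR D.Y D.B
    rw [Category.assoc, tensorHom_projR, reassoc_of% @inv_q_projR]

end Equivalence

end BimonSplit

end

open BimonSplit

theorem proposition1p4 {M : Type u} [Category.{v} M] [MonoidalCategory M] [SymmetricCategory M]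
    [HasEqualizers M]
    [∀ X : M, PreservesLimitsOfShape WalkingParallelPair (tensorLeft X)] :
    -- `q` is invertible, with explicit inverse, as soon as `B` has an antipode
    (∀ X : SplitEpiBimon M, X.CocommAlong → ∀ z : X.B ⟶ X.B, IsAntipode X.B z →
      ∃ r : X.A ⟶ X.cotensor ⊗ X.B, X.q ≫ r = 𝟙 _ ∧ r ≫ X.q = 𝟙 _ ∧
        r ≫ X.j ▷ X.B =
          Δ[X.A] ≫ X.A ◁ X.s ≫ X.A ◁ Δ[X.B] ≫ X.A ◁ (z ▷ X.B) ≫ X.A ◁ (X.i ▷ X.B) ≫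
            (α_ X.A X.A X.B).inv ≫ μ[X.A] ▷ X.B) ∧
    -- the full subcategories are nested
    ∃ (hS₁ : SplitEpiBimon.hopfCodomain M ≤ SplitEpiBimon.isRegular M)
      (hS₂ : SplitEpiBimon.cocommHopf M ≤ SplitEpiBimon.hopfCodomain M)
      (hD₁ : ActBimon.cocommHopfActing M ≤ ActBimon.cocomm M)
      (hD₂ : ActBimon.cocommHopf M ≤ ActBimon.cocommHopfActing M)
      -- the ambient equivalence and its two restrictions
      (E : (SplitEpiBimon.isRegular M).FullSubcategory ≌ (ActBimon.cocomm M).FullSubcategory)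
      (E₁ : (SplitEpiBimon.hopfCodomain M).FullSubcategory ≌
        (ActBimon.cocommHopfActing M).FullSubcategory)
      (E₂ : (SplitEpiBimon.cocommHopf M).FullSubcategory ≌
        (ActBimon.cocommHopf M).FullSubcategory),
      Nonempty (E₁.functor ⋙ ObjectProperty.ιOfLE hD₁ ≅
        ObjectProperty.ιOfLE hS₁ ⋙ E.functor) ∧
      Nonempty (E₂.functor ⋙ ObjectProperty.ιOfLE hD₂ ≅
        ObjectProperty.ιOfLE hS₂ ⋙ E₁.functor) ∧
      -- `E` is given by the cotensor product, naturally
      (∃ κ : ∀ X : (SplitEpiBimon.isRegular M).FullSubcategory,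
          CotensorIso X.obj (E.functor.obj X).obj,
        ∀ {X X' : (SplitEpiBimon.isRegular M).FullSubcategory} (f : X ⟶ X'),
          (E.functor.map f).hom.b ≫ (κ X').isoB.hom = (κ X).isoB.hom ≫ f.hom.b ∧
          (E.functor.map f).hom.y ≫ (κ X').isoY.hom ≫ X'.obj.j =
            (κ X).isoY.hom ≫ X.obj.j ≫ f.hom.a) ∧
      -- the inverse of `E` is given by the smash product, naturally
      (∃ σ : ∀ D : (ActBimon.cocomm M).FullSubcategory,
          SmashIso D.obj (E.inverse.obj D).obj,
        ∀ {D D' : (ActBimon.cocomm M).FullSubcategory} (g : D ⟶ D'),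
          (E.inverse.map g).hom.b ≫ (σ D').isoB.hom = (σ D).isoB.hom ≫ g.hom.b ∧
          (E.inverse.map g).hom.a ≫ (σ D').isoA.hom =
            (σ D).isoA.hom ≫ (g.hom.y ⊗ₘ g.hom.b)) := by
  refine ⟨fun X hX z hz => ?_, SplitEpiBimon.hopfCodomain_le_isRegular,
    SplitEpiBimon.cocommHopf_le_hopfCodomain, ActBimon.cocommHopfActing_le_cocomm,
    ActBimon.cocommHopf_le_cocommHopfActing, (SplitEpiBimon.toActFunctor M).asEquivalence,
    (SplitEpiBimon.toActFunctorHopf M).asEquivalence,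
    (SplitEpiBimon.toActFunctorCocommHopf M).asEquivalence, ⟨Iso.refl _⟩, ⟨Iso.refl _⟩,
    ⟨fun X => cotensorIsoToAct X.obj, fun {X X'} f => ⟨?_, ?_⟩⟩, ?_⟩
  · have : Fact X.CocommAlong := ⟨hX⟩
    exact SplitEpiBimon.exists_inverse_q hz
  · exact (Category.comp_id f.hom.b).trans (Category.id_comp f.hom.b).symm
  · change SplitEpiBimon.restrict f.hom ≫ 𝟙 _ ≫ X'.obj.j = 𝟙 _ ≫ X.obj.j ≫ f.hom.a
    rw [Category.id_comp, Category.id_comp, SplitEpiBimon.restrict_j]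
  · let E := (SplitEpiBimon.toActFunctor M).asEquivalence
    let e (D : (ActBimon.cocomm M).FullSubcategory) : (E.inverse.obj D).obj.toAct ≅ D.obj :=
      (ObjectProperty.ι _).mapIso (E.counitIso.app D)
    refine ⟨fun D => @smashIsoOfIso _ _ _ _ _ _ (E.inverse.obj D).obj _ _ D.obj
      (ActBimon.isoB (e D)) (ActBimon.isoY (e D)) (e D).hom.bimon_b (e D).hom.bimon_y
      (e D).hom.comm_l, fun {D D'} g => ?_⟩
    have h := E.counitIso.hom.naturality g
    have hb : (E.inverse.map g).hom.b ≫ (e D').hom.b = (e D).hom.b ≫ g.hom.b :=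
      congrArg (fun f => f.hom.b) h
    have hy : SplitEpiBimon.restrict (E.inverse.map g).hom ≫ (e D').hom.y =
        (e D).hom.y ≫ g.hom.y :=
      congrArg (fun f => f.hom.y) h
    have hq : (E.inverse.map g).hom.a ≫ inv (E.inverse.obj D').obj.q =
        inv (E.inverse.obj D).obj.q ≫
          (SplitEpiBimon.restrict (E.inverse.map g).hom ⊗ₘ (E.inverse.map g).hom.b) := by
      rw [IsIso.comp_inv_eq, Category.assoc, SplitEpiBimon.restrict_tensor_q,
        IsIso.inv_hom_id_assoc]
    refine ⟨hb, ?_⟩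
    change (E.inverse.map g).hom.a ≫ inv (E.inverse.obj D').obj.q ≫
        ((e D').hom.y ⊗ₘ (e D').hom.b) =
      (inv (E.inverse.obj D).obj.q ≫ ((e D).hom.y ⊗ₘ (e D).hom.b)) ≫ _
    rw [reassoc_of% hq, Category.assoc]
    congr 1
    refine (tensorHom_comp_tensorHom _ _ _ _).trans
      (Eq.trans ?_ (tensorHom_comp_tensorHom _ _ _ _).symm)
    exact congrArg₂ (fun p q => p ⊗ₘ q) hy hb
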